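/- Let $G$ be a finite group, $g\in G$, let $m$ be an integer and let $d$ be a positive integer dividing $\exp(G)$. Let $D(G)$ be the Drinfeld double of the complex group algebra of $G$. For $\eta\in\mathrm{Irr}(C_G(g))$ (irreducible complex characters of the centralizer of $g$) let $\nu_m(g,\eta)=\chi_V(\Lambda^{[m]})$ be the $m$-th Frobenius–Schur indicator of the simple $D(G)$-module $V$ described by the pair $(g,\eta)$; here $\chi_V$ is the character of $V$, $\Lambda$ is the two-sided integral of $D(G)$ with $\varepsilon(\Lambda)=1$, and $\Lambda^{[m]}$ is the image of $\Lambda$ under the $m$-th convolution power of $\mathrm{id}_{D(G)}$ (for $m<0$: the $|m|$-th convolution power of the antipode). Let $$N_G^d(g)=\{t\in G\mid tgt^{-1}=g^r\text{ for some integer } r \text{ with }(r,\exp(G))=1\text{ and }r\equiv 1 \bmod d\},$$ a subgroup of $G$ which contains $C_G(g)$ and acts on $\mathrm{Irr}(C_G(g))$ by $(t\cdot\eta)(x)=\eta(t^{-1}xt)$. Let $\zeta_d=e^{2\pi i/d}$. Assume that $\nu_m(g,\eta)\in\mathbb Q(\zeta_d)$ for all $\eta\in\mathrm{Irr}(C_G(g))$.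 Then 1. $\nu_m(g,\eta)$ depends only on the induced character $\mathrm{Ind}_{C_G(g)}^{N_G^d(g)}(\eta)$: if $\eta,\eta'\in\mathrm{Irr}(C_G(g))$ satisfy $\mathrm{Ind}_{C_G(g)}^{N_G^d(g)}(\eta)=\mathrm{Ind}_{C_G(g)}^{N_G^d(g)}(\eta')$, then $\nu_m(g,\eta)=\nu_m(g,\eta')$; 2. equivalently, $\nu_m(g,\cdot)$ is invariant under $N_G^d(g)$: $\nu_m(g,t\cdot\eta)=\nu_m(g,\eta)$ for all $t\in N_G^d(g)$ and $\eta\in\mathrm{Irr}(C_G(g))$. The properties 1 and 2 are equivalent to each other (also without the assumption on the values $\nu_m(g,\eta)$). -/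

import Mathlib

open scoped TensorProduct

set_option linter.unusedSectionVars false

noncomputable section

/-! ### Sweedler powers, integrals and higher Frobenius-Schur indicators -/

section Indicators

variable {k H : Type*} [Field k] [Ring H] [HopfAlgebra k H]

/-- The `m`-th Sweedler power map `h ↦ h^[m]` of a Hopf algebra, that is, the `m`-th convolution
power of the identity map: `h^[m] = h₁ h₂ ⋯ hₘ` for `m > 0`, `h^[0] = ε(h) 1`, and for negative
exponents `h^[-n] = S(h₁) S(h₂) ⋯ S(hₙ)`, the antipode `S` being the convolution inverse of the
identity. -/
def sweedlerPower (k : Type*) {H : Type*} [Field k] [Ring H] [HopfAlgebra k H] (m : ℤ) :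
    H →ₗ[k] H :=
  match m with
  | Int.ofNat n => (WithConv.toConv (LinearMap.id : H →ₗ[k] H) ^ n).ofConv
  | Int.negSucc n => (WithConv.toConv (HopfAlgebra.antipode k : H →ₗ[k] H) ^ (n + 1)).ofConv

/-- `Λ` is the normalized two-sided integral of `H`: `h Λ = ε(h) Λ = Λ h` and `ε(Λ) = 1`.
There is at most one such element. -/
structure IsNormalizedIntegral (k : Type*) {H : Type*} [Field k] [Ring H] [HopfAlgebra k H]
    (Λ : H) : Prop where
  left : ∀ h : H, h * Λ = Coalgebra.counit (R := k) h • Λ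
  right : ∀ h : H, Λ * h = Coalgebra.counit (R := k) h • Λ
  counit : Coalgebra.counit (R := k) Λ = 1

theorem IsNormalizedIntegral.unique {Λ Λ' : H} (h : IsNormalizedIntegral k Λ)
    (h' : IsNormalizedIntegral k Λ') : Λ = Λ' := by
  have h1 := h.left Λ'
  have h2 := h'.right Λ
  rw [h'.counit, one_smul] at h1
  rw [h.counit, one_smul] at h2
  exact h1.symm.trans h2

/-- The `m`-th Frobenius-Schur indicator `χ_V(Λ^[m])` of an `H`-module `V` with structure map
`π : H → End(V)`, where `Λ` is the normalized integral of `H`. -/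
def frobeniusSchurIndicator {V : Type*} [AddCommGroup V] [Module k V]
    {Λ : H} (_hΛ : IsNormalizedIntegral k Λ) (m : ℤ) (π : H →ₐ[k] Module.End k V) : k :=
  LinearMap.trace k V (π (sweedlerPower k m Λ))

end Indicators

/-! ### The Drinfeld double of the complex group algebra of a finite group -/

/-- The underlying space of the Drinfeld double `D(G)` of the group algebra `ℂ[G]`, with basis
`e_x ⋈ y` for `x, y ∈ G`; the function `a` stands for `∑ a (x, y) • (e_x ⋈ y)`. -/
def DrinfeldDouble (G : Type*) : Type _ := G × G → ℂ

namespace DrinfeldDouble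

variable {G : Type*}

instance : AddCommGroup (DrinfeldDouble G) := inferInstanceAs (AddCommGroup (G × G → ℂ))

instance : Module ℂ (DrinfeldDouble G) := inferInstanceAs (Module ℂ (G × G → ℂ))

variable [Group G] [Fintype G] [DecidableEq G]

/-- The basis of `D(G)` whose element of index `(x, y)` is `e_x ⋈ y`. -/
def basis (G : Type*) [Fintype G] : Module.Basis (G × G) ℂ (DrinfeldDouble G) :=
  Pi.basisFun ℂ (G × G)

/-- The basis element `e_x ⋈ y`. -/
def of (x y : G) : DrinfeldDouble G := fun p => if p = (x, y) then 1 else 0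

theorem basis_apply (p : G × G) : basis G p = of p.1 p.2 := by
  change Pi.basisFun ℂ (G × G) p = of p.1 p.2
  ext q
  simp [of, Pi.basisFun_apply, Pi.single_apply]

@[ext] theorem ext {a b : DrinfeldDouble G} (h : ∀ x y, a (x, y) = b (x, y)) : a = b :=
  funext fun p => h p.1 p.2

@[simp] theorem add_apply (a b : DrinfeldDouble G) (p : G × G) : (a + b) p = a p + b p := rfl

@[simp] theorem zero_apply (p : G × G) : (0 : DrinfeldDouble G) p = 0 := rfl

@[simp] theorem neg_apply (a : DrinfeldDouble G) (p : G × G) : (-a) p = -a p := rfl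

@[simp] theorem smul_apply (c : ℂ) (a : DrinfeldDouble G) (p : G × G) : (c • a) p = c * a p := rfl

@[simp] theorem sum_apply {ι : Type*} (s : Finset ι) (f : ι → DrinfeldDouble G) (p : G × G) :
    (∑ i ∈ s, f i) p = ∑ i ∈ s, f i p :=
  Finset.sum_apply (M := fun _ : G × G => ℂ) p s f

/-- The multiplication with `(e_x ⋈ y) (e_x' ⋈ y') = δ_{x, y x' y⁻¹} e_x ⋈ y y'`. -/
instance : Mul (DrinfeldDouble G) where
  mul a b := fun p => ∑ u : G, a (p.1, u) * b (u⁻¹ * p.1 * u, u⁻¹ * p.2)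

/-- The unit `∑ e_x ⋈ 1`. -/
instance : One (DrinfeldDouble G) where
  one := fun p => if p.2 = 1 then 1 else 0

theorem mul_apply (a b : DrinfeldDouble G) (x y : G) :
    (a * b) (x, y) = ∑ u : G, a (x, u) * b (u⁻¹ * x * u, u⁻¹ * y) := rfl

theorem one_apply (x y : G) : (1 : DrinfeldDouble G) (x, y) = if y = 1 then 1 else 0 := rfl

instance : Ring (DrinfeldDouble G) where
  __ := (inferInstance : AddCommGroup (DrinfeldDouble G))
  left_distrib a b c := by ext; simp [mul_apply, mul_add, Finset.sum_add_distrib]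
  right_distrib a b c := by ext; simp [mul_apply, add_mul, Finset.sum_add_distrib]
  zero_mul a := by ext; simp [mul_apply]
  mul_zero a := by ext; simp [mul_apply]
  one_mul a := by ext; simp [mul_apply, one_apply]
  mul_one a := by ext; simp [mul_apply, one_apply, inv_mul_eq_one]
  mul_assoc a b c := by
    ext x y
    simp only [mul_apply, Finset.sum_mul, Finset.mul_sum]
    rw [Finset.sum_comm]
    refine Finset.sum_congr rfl fun u _ => ?_
    refine Fintype.sum_equiv (Equiv.mulLeft u⁻¹) _ _ fun v => ?_
    simp [mul_assoc]

instance : Algebra ℂ (DrinfeldDouble G) :=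
  Algebra.ofModule
    (fun c a b => by ext; simp [mul_apply, Finset.mul_sum, mul_assoc])
    (fun c a b => by ext; simp [mul_apply, Finset.mul_sum, mul_left_comm])

theorem of_mul_of (x y x' y' : G) :
    of x y * of x' y' = if x = y * x' * y⁻¹ then of x (y * y') else 0 := by
  ext p q
  rw [mul_apply, Finset.sum_eq_single y]
  · have h1 : y⁻¹ * p * y = x' ↔ p = y * x' * y⁻¹ := by
      rw [eq_mul_inv_iff_mul_eq, mul_assoc, inv_mul_eq_iff_eq_mul]
    have h2 : y⁻¹ * q = y' ↔ q = y * y' := inv_mul_eq_iff_eq_mul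
    by_cases hx : x = y * x' * y⁻¹
    · simp only [of, Prod.mk.injEq, h1, h2, and_true, if_pos hx]
      rw [← hx]
      by_cases hp : p = x <;> simp [hp]
    · simp only [of, Prod.mk.injEq, h1, h2, and_true, if_neg hx]
      by_cases hp : p = x
      · subst hp
        simp [hx]
      · simp [hp]
  · intro u _ hu
    simp [of, hu]
  · simp

theorem one_eq_sum : (1 : DrinfeldDouble G) = ∑ x : G, of x 1 := by
  ext p q
  simp [one_apply, of, Prod.mk.injEq, Finset.sum_ite_eq, ite_and]

theorem hom_ext {M : Type*} [AddCommGroup M] [Module ℂ M] {f f' : DrinfeldDouble G →ₗ[ℂ] M}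
    (h : ∀ x y, f (of x y) = f' (of x y)) : f = f' :=
  (basis G).ext fun p => by rw [basis_apply]; exact h p.1 p.2

/-- The coproduct `Δ(e_x ⋈ y) = ∑_{vu = x} (e_u ⋈ y) ⊗ (e_v ⋈ y)` and the counit
`ε(e_x ⋈ y) = δ_{x, 1}`. -/
instance : CoalgebraStruct ℂ (DrinfeldDouble G) where
  comul := (basis G).constr ℂ fun p => ∑ u : G, of u p.2 ⊗ₜ[ℂ] of (p.1 * u⁻¹) p.2
  counit := (basis G).constr ℂ fun p => if p.1 = 1 then 1 else 0

theorem comul_of (x y : G) : Coalgebra.comul (R := ℂ) (of x y) =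
    ∑ u : G, of u y ⊗ₜ[ℂ] of (x * u⁻¹) y := by
  have := (basis G).constr_basis ℂ
    (fun p => ∑ u : G, of u p.2 ⊗ₜ[ℂ] of (p.1 * u⁻¹) p.2) (x, y)
  rwa [basis_apply] at this

theorem counit_of (x y : G) :
    Coalgebra.counit (R := ℂ) (of x y) = if x = 1 then 1 else 0 := by
  have := (basis G).constr_basis ℂ
    (fun p => if p.1 = 1 then (1 : ℂ) else 0) (x, y)
  rwa [basis_apply] at this

instance : Coalgebra ℂ (DrinfeldDouble G) where
  coassoc := by
    refine hom_ext fun x y => ?_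
    simp only [LinearMap.comp_apply, comul_of, map_sum, LinearMap.rTensor_tmul,
      LinearMap.lTensor_tmul, TensorProduct.sum_tmul, TensorProduct.tmul_sum,
      LinearEquiv.coe_coe, TensorProduct.assoc_tmul]
    rw [Finset.sum_comm]
    refine Finset.sum_congr rfl fun u _ => ?_
    refine Fintype.sum_equiv (Equiv.mulRight u⁻¹) _ _ fun v => ?_
    simp [mul_assoc]
  rTensor_counit_comp_comul := by
    refine hom_ext fun x y => ?_
    simp [comul_of, counit_of, TensorProduct.ite_tmul]
  lTensor_counit_comp_comul := by
    refine hom_ext fun x y => ?_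
    simp [comul_of, counit_of, TensorProduct.tmul_ite, mul_inv_eq_one]

theorem bilin_ext {M : Type*} [AddCommGroup M] [Module ℂ M]
    {f f' : DrinfeldDouble G →ₗ[ℂ] DrinfeldDouble G →ₗ[ℂ] M}
    (h : ∀ x y x' y', f (of x y) (of x' y') = f' (of x y) (of x' y')) : f = f' :=
  hom_ext fun x y => hom_ext fun x' y' => h x y x' y'

instance : Bialgebra ℂ (DrinfeldDouble G) where
  counit_one := by simp [one_eq_sum, counit_of]
  mul_compr₂_counit := by
    refine bilin_ext fun x y x' y' => ?_
    simp only [LinearMap.compr₂_apply, LinearMap.mul_apply', LinearMap.compl₁₂_apply, of_mul_of,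
      counit_of, apply_ite (Coalgebra.counit (R := ℂ)), map_zero]
    by_cases hx : x = 1
    · subst hx
      by_cases hx' : x' = 1
      · simp [hx']
      · have : ¬ (1 = y * x' * y⁻¹) := by
          rw [eq_mul_inv_iff_mul_eq, one_mul, left_eq_mul]; exact hx'
        simp [hx', this]
    · simp [hx]
  comul_one := by
    rw [one_eq_sum, map_sum]
    simp only [comul_of]
    rw [Algebra.TensorProduct.one_def, one_eq_sum, TensorProduct.sum_tmul, Finset.sum_comm]
    refine Finset.sum_congr rfl fun u _ => ?_
    rw [TensorProduct.tmul_sum]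
    exact Fintype.sum_equiv (Equiv.mulRight u⁻¹) _ _ fun v => by simp
  mul_compr₂_comul := by
    refine bilin_ext fun x y x' y' => ?_
    simp only [LinearMap.compr₂_apply, LinearMap.mul_apply', LinearMap.compl₁₂_apply, of_mul_of,
      comul_of, apply_ite (Coalgebra.comul (R := ℂ)), map_zero, Finset.sum_mul_sum,
      Algebra.TensorProduct.tmul_mul_tmul]
    have key : ∀ u : G, ∑ v : G,
        (if u = y * v * y⁻¹ then of u (y * y') else 0) ⊗ₜ[ℂ]
          (if x * u⁻¹ = y * (x' * v⁻¹) * y⁻¹ then of (x * u⁻¹) (y * y') else 0) =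
        if x = y * x' * y⁻¹ then of u (y * y') ⊗ₜ[ℂ] of (x * u⁻¹) (y * y') else 0 := by
      intro u
      rw [Finset.sum_eq_single (y⁻¹ * u * y)]
      · have h1 : u = y * (y⁻¹ * u * y) * y⁻¹ := by group
        have h2 : x * u⁻¹ = y * (x' * (y⁻¹ * u * y)⁻¹) * y⁻¹ ↔ x = y * x' * y⁻¹ := by
          rw [mul_inv_eq_iff_eq_mul]
          have : y * (x' * (y⁻¹ * u * y)⁻¹) * y⁻¹ * u = y * x' * y⁻¹ := by group
          rw [this]
        rw [if_pos h1]
        simp only [h2]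
        split_ifs <;> simp
      · intro v _ hv
        rw [if_neg, TensorProduct.zero_tmul]
        rintro rfl
        exact hv (by group)
      · simp
    rw [Finset.sum_congr rfl fun u _ => key u]
    split_ifs <;> simp

/-- The antipode `S(e_x ⋈ y) = e_{y⁻¹ x⁻¹ y} ⋈ y⁻¹`. -/
instance : HopfAlgebraStruct ℂ (DrinfeldDouble G) where
  antipode := (basis G).constr ℂ fun p => of (p.2⁻¹ * p.1⁻¹ * p.2) p.2⁻¹

theorem antipode_of (x y : G) :
    HopfAlgebra.antipode ℂ (of x y) = of (y⁻¹ * x⁻¹ * y) y⁻¹ := by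
  have := (basis G).constr_basis ℂ
    (fun p => of (p.2⁻¹ * p.1⁻¹ * p.2) p.2⁻¹) (x, y)
  rwa [basis_apply] at this

instance : HopfAlgebra ℂ (DrinfeldDouble G) where
  mul_antipode_rTensor_comul := by
    refine hom_ext fun x y => ?_
    simp only [LinearMap.comp_apply, comul_of, map_sum, LinearMap.rTensor_tmul,
      LinearMap.mul'_apply, antipode_of, of_mul_of, counit_of, Algebra.linearMap_apply]
    have h : ∀ u : G, y⁻¹ * u⁻¹ * y = y⁻¹ * (x * u⁻¹) * y⁻¹⁻¹ ↔ x = 1 := by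
      intro u
      simp [mul_assoc]
    simp only [h]
    by_cases hx : x = 1
    · simp only [hx, if_true, map_one, one_eq_sum, inv_mul_cancel]
      exact Fintype.sum_equiv ((Equiv.inv G).trans (MulAut.conj y⁻¹).toEquiv) _ _ fun v => by simp
    · simp [hx]
  mul_antipode_lTensor_comul := by
    refine hom_ext fun x y => ?_
    simp only [LinearMap.comp_apply, comul_of, map_sum, LinearMap.lTensor_tmul,
      LinearMap.mul'_apply, antipode_of, of_mul_of, counit_of, Algebra.linearMap_apply]
    have h : ∀ u : G, u = y * (y⁻¹ * (x * u⁻¹)⁻¹ * y) * y⁻¹ ↔ x = 1 := by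
      intro u
      have : y * (y⁻¹ * (x * u⁻¹)⁻¹ * y) * y⁻¹ = u * x⁻¹ := by group
      rw [this, left_eq_mul, inv_eq_one]
    simp only [h]
    by_cases hx : x = 1
    · simp [hx, one_eq_sum]
    · simp [hx]

/-- The element `|G|⁻¹ ∑_y e_1 ⋈ y`. -/
def integral (G : Type*) [Group G] [Fintype G] [DecidableEq G] : DrinfeldDouble G :=
  (Fintype.card G : ℂ)⁻¹ • ∑ y : G, of 1 y

theorem isNormalizedIntegral_integral : IsNormalizedIntegral ℂ (integral G) where
  left h := by
    refine LinearMap.congr_fun (f := LinearMap.mulRight ℂ (integral G))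
      (g := Coalgebra.counit.smulRight (integral G)) (hom_ext fun x y => ?_) h
    simp only [LinearMap.mulRight_apply, LinearMap.smulRight_apply, integral, mul_smul_comm,
      Finset.mul_sum, of_mul_of, counit_of, mul_one, mul_inv_cancel]
    by_cases hx : x = 1
    · simp only [hx, if_true, one_smul]
      congr 1
      exact Fintype.sum_equiv (Equiv.mulLeft y) _ _ fun v => by simp
    · simp [hx]
  right h := by
    refine LinearMap.congr_fun (f := LinearMap.mulLeft ℂ (integral G))
      (g := Coalgebra.counit.smulRight (integral G)) (hom_ext fun x y => ?_) h
    simp only [LinearMap.mulLeft_apply, LinearMap.smulRight_apply, integral, smul_mul_assoc,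
      Finset.sum_mul, of_mul_of, counit_of]
    have h : ∀ u : G, 1 = u * x * u⁻¹ ↔ x = 1 := by
      intro u
      rw [eq_mul_inv_iff_mul_eq, one_mul, left_eq_mul]
    simp only [h]
    by_cases hx : x = 1
    · simp only [hx, if_true, one_smul]
      congr 1
      exact Fintype.sum_equiv (Equiv.mulRight y) _ _ fun v => by simp
    · simp [hx]
  counit := by
    simp [integral, counit_of]

end DrinfeldDouble

/-! ### Irreducible characters and simple modules over the double -/

/-- The irreducible complex characters of a finite group `H`. -/
def IrrChar (H : Type*) [Group H] : Type _ :=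
  {χ : H → ℂ // ∃ (n : ℕ) (ρ : Representation ℂ H (Fin n → ℂ)),
    ρ.IsIrreducible ∧ ρ.character = χ}

namespace IrrChar

variable {H : Type*} [Group H]

instance : CoeFun (IrrChar H) fun _ => H → ℂ := ⟨Subtype.val⟩

/-- The degree of a representation affording the irreducible character `η`. -/
def degree (η : IrrChar H) : ℕ := η.2.choose

/-- A representation affording the irreducible character `η`; it is unique up to isomorphism. -/
def rep (η : IrrChar H) : Representation ℂ H (Fin η.degree → ℂ) := η.2.choose_spec.choose

theorem rep_isIrreducible (η : IrrChar H) : η.rep.IsIrreducible := η.2.choose_spec.choose_spec.1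

theorem rep_character (η : IrrChar H) : η.rep.character = η := η.2.choose_spec.choose_spec.2

/-- The character of the representation induced from a representation affording `η`. -/
def induced {G : Type*} [Group G] {H K : Subgroup G} (h : H ≤ K) (η : IrrChar H) : K → ℂ :=
  (Representation.ind (Subgroup.inclusion h) η.rep).character

end IrrChar

section DoubleModule

variable {G : Type*} [Group G]

/-- The space of the `D(G)`-module described by `g ∈ G` and a representation `ρ` of `C_G(g)` on
`W`: the induced representation `Ind_{C_G(g)}^G W`, realized as the functions `f : G → W` with
`f (t c) = ρ(c)⁻¹ f(t)` for `c ∈ C_G(g)`. -/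
def doubleModule (g : G) {W : Type*} [AddCommGroup W] [Module ℂ W]
    (ρ : Representation ℂ (Subgroup.centralizer {g}) W) : Submodule ℂ (G → W) where
  carrier := {f | ∀ (t : G) (c : Subgroup.centralizer {g}), f (t * c) = ρ c⁻¹ (f t)}
  add_mem' hf hf' t c := by simp [hf t c, hf' t c]
  zero_mem' t c := by simp
  smul_mem' a f hf t c := by simp [hf t c]

variable [Fintype G] [DecidableEq G]

/-- The action of `D(G)` on the module described by `(g, ρ)`: the group acts by
`(y f)(t) = f(y⁻¹ t)` and `e_x` is the projection onto the functions supported on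
`{t | t g t⁻¹ = x}`, so that `((e_x ⋈ y) f)(t) = δ_{x, t g t⁻¹} f(y⁻¹ t)`. -/
def doubleRep (g : G) {W : Type*} [AddCommGroup W] [Module ℂ W]
    (ρ : Representation ℂ (Subgroup.centralizer {g}) W) :
    DrinfeldDouble G →ₐ[ℂ] Module.End ℂ (doubleModule g ρ) :=
  AlgHom.ofLinearMap
    { toFun := fun a =>
        { toFun := fun f => ⟨fun t => ∑ y : G, a (t * g * t⁻¹, y) • f.1 (y⁻¹ * t), by
            intro t c
            have hc : (c : G) * g * (c : G)⁻¹ = g := by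
              rw [mul_inv_eq_iff_eq_mul]
              exact (Subgroup.mem_centralizer_singleton_iff.mp c.2)
            have h : t * c * g * (t * c)⁻¹ = t * g * t⁻¹ := by
              calc t * c * g * (t * c)⁻¹ = t * (c * g * (c : G)⁻¹) * t⁻¹ := by group
                _ = _ := by rw [hc]
            simp only [h, map_sum, map_smul]
            refine Finset.sum_congr rfl fun y _ => ?_
            rw [← mul_assoc, f.2 (y⁻¹ * t) c]⟩
          map_add' := fun f f' => by
            ext t
            simp [Finset.sum_add_distrib]
          map_smul' := fun r f => by
            ext t
            simp [Finset.smul_sum, smul_comm r] }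
      map_add' := fun a b => by
        ext f t
        simp [add_smul, Finset.sum_add_distrib]
      map_smul' := fun r a => by
        ext f t
        simp [Finset.smul_sum, mul_smul] }
    (by
      ext f t
      simp [DrinfeldDouble.one_apply])
    (by
      intro a b
      ext f t
      simp only [LinearMap.coe_mk, AddHom.coe_mk, Module.End.mul_apply, DrinfeldDouble.mul_apply,
        Finset.sum_smul, Finset.smul_sum]
      refine Finset.sum_comm.trans ?_
      refine Finset.sum_congr rfl fun u _ => ?_
      refine Fintype.sum_equiv (Equiv.mulLeft u⁻¹) _ _ fun y => ?_
      simp [mul_assoc, mul_smul])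

theorem doubleRep_of (g : G) {W : Type*} [AddCommGroup W] [Module ℂ W]
    (ρ : Representation ℂ (Subgroup.centralizer {g}) W) (x y : G) (f : doubleModule g ρ) (t : G) :
    (doubleRep g ρ (DrinfeldDouble.of x y) f).1 t =
      if t * g * t⁻¹ = x then f.1 (y⁻¹ * t) else 0 := by
  change ∑ u : G, DrinfeldDouble.of x y (t * g * t⁻¹, u) • f.1 (u⁻¹ * t) = _
  by_cases h : t * g * t⁻¹ = x <;> simp [DrinfeldDouble.of, h]

/-- The `m`-th Frobenius-Schur indicator `ν_m(g, η)` of the simple `D(G)`-module described by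
`g ∈ G` and an irreducible character `η` of `C_G(g)`. -/
def doubleIndicator (m : ℤ) (g : G) (η : IrrChar (Subgroup.centralizer {g})) : ℂ :=
  frobeniusSchurIndicator DrinfeldDouble.isNormalizedIntegral_integral m (doubleRep g η.rep)

end DoubleModule

/-! ### The restricted normalizer -/

section RestrictedNormalizer

variable {G : Type*} [Group G] [Finite G]

/-- The restricted normalizer
`N_G^d(g) = {t | t g t⁻¹ = g ^ r for some r coprime to exp(G) with r ≡ 1 mod d}`. -/
def restrictedNormalizer (d : ℕ) (g : G) : Subgroup G where
  carrier := {t | ∃ r : ℤ, IsCoprime r (Monoid.exponent G : ℤ) ∧ r ≡ 1 [ZMOD d] ∧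
    t * g * t⁻¹ = g ^ r}
  one_mem' := ⟨1, isCoprime_one_left, rfl, by simp⟩
  mul_mem' := by
    rintro s t ⟨r, hr, hrd, hs⟩ ⟨q, hq, hqd, ht⟩
    refine ⟨r * q, hr.mul_left hq, by simpa using hrd.mul hqd, ?_⟩
    calc s * t * g * (s * t)⁻¹ = s * (t * g * t⁻¹) * s⁻¹ := by group
      _ = g ^ (r * q) := by rw [ht, ← conj_zpow, hs, zpow_mul]
  inv_mem' := by
    rintro t ⟨r, hr, hrd, ht⟩
    have key : ∀ n : ℕ, t ^ n * g * (t ^ n)⁻¹ = g ^ (r ^ n) := by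
      intro n
      induction n with
      | zero => simp
      | succ n ih =>
        calc t ^ (n + 1) * g * (t ^ (n + 1))⁻¹ = t * (t ^ n * g * (t ^ n)⁻¹) * t⁻¹ := by
              rw [pow_succ']; group
          _ = g ^ (r ^ (n + 1)) := by rw [ih, ← conj_zpow, ht, ← zpow_mul, pow_succ']
    have hinv : t⁻¹ = t ^ (orderOf t - 1) := by
      rw [inv_eq_iff_mul_eq_one, ← pow_succ', Nat.sub_add_cancel (orderOf_pos t),
        pow_orderOf_eq_one]
    refine ⟨r ^ (orderOf t - 1), hr.pow_left, by simpa using hrd.pow (orderOf t - 1), ?_⟩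
    rw [hinv]
    exact key _

theorem centralizer_le_restrictedNormalizer (d : ℕ) (g : G) :
    Subgroup.centralizer {g} ≤ restrictedNormalizer d g := by
  intro c hc
  refine ⟨1, isCoprime_one_left, rfl, ?_⟩
  rw [zpow_one, mul_inv_eq_iff_eq_mul]
  exact Subgroup.mem_centralizer_singleton_iff.mp hc

theorem conj_mem_centralizer {d : ℕ} {g t : G} (ht : t ∈ restrictedNormalizer d g) {x : G}
    (hx : x ∈ Subgroup.centralizer {g}) : t⁻¹ * x * t ∈ Subgroup.centralizer {g} := by
  obtain ⟨r, -, -, h⟩ := ht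
  rw [Subgroup.mem_centralizer_singleton_iff] at hx ⊢
  have h1 : Commute x (t * g * t⁻¹) := by
    rw [h]
    exact Commute.zpow_right hx r
  calc t⁻¹ * x * t * g = t⁻¹ * (x * (t * g * t⁻¹)) * t := by group
    _ = t⁻¹ * ((t * g * t⁻¹) * x) * t := by rw [h1.eq]
    _ = g * (t⁻¹ * x * t) := by group

/-- For `t ∈ N_G^d(g)`, the endomorphism `x ↦ t⁻¹ x t` of `C_G(g)`. -/
def centralizerConj {d : ℕ} {g : G} (t : restrictedNormalizer d g) :
    Subgroup.centralizer {g} →* Subgroup.centralizer {g} where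
  toFun x := ⟨(t : G)⁻¹ * x * t, conj_mem_centralizer t.2 x.2⟩
  map_one' := by ext; simp
  map_mul' x y := by ext; simp [mul_assoc]

theorem centralizerConj_surjective {d : ℕ} {g : G} (t : restrictedNormalizer d g) :
    Function.Surjective (centralizerConj t) := by
  intro x
  refine ⟨centralizerConj t⁻¹ x, ?_⟩
  ext
  simp [centralizerConj, mul_assoc]

theorem isIrreducible_comp {H W : Type*} [Group H] [AddCommGroup W] [Module ℂ W]
    (ρ : Representation ℂ H W) (hρ : ρ.IsIrreducible) (φ : H →* H) (hφ : Function.Surjective φ) :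
    Representation.IsIrreducible (MonoidHom.comp ρ φ : Representation ℂ H W) := by
  let e : Subrepresentation (MonoidHom.comp ρ φ : Representation ℂ H W) ≃o Subrepresentation ρ :=
    { toFun := fun U => ⟨U.toSubmodule, fun h v hv => by
        obtain ⟨h, rfl⟩ := hφ h
        exact U.apply_mem_toSubmodule h hv⟩
      invFun := fun U => ⟨U.toSubmodule, fun h v hv => U.apply_mem_toSubmodule (φ h) hv⟩
      left_inv := fun U => rfl
      right_inv := fun U => rfl
      map_rel_iff' := Iff.rfl }
  exact e.isSimpleOrder_iff.mpr hρ

/-- The action of `N_G^d(g)` on the irreducible characters of `C_G(g)`: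
`(t • η)(x) = η(t⁻¹ x t)`. -/
instance restrictedNormalizerAction (d : ℕ) (g : G) :
    MulAction (restrictedNormalizer d g) (IrrChar (Subgroup.centralizer {g})) where
  smul t η := ⟨fun x => η (centralizerConj t x),
    η.degree, MonoidHom.comp η.rep (centralizerConj t),
    isIrreducible_comp _ η.rep_isIrreducible _ (centralizerConj_surjective t), by
      rw [← η.rep_character]; rfl⟩
  one_smul η := by
    refine Subtype.ext (funext fun x => congrArg η (Subtype.ext ?_))
    simp [centralizerConj]
  mul_smul s t η := by
    refine Subtype.ext (funext fun x => congrArg η (Subtype.ext ?_))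
    simp [centralizerConj, mul_assoc]

end RestrictedNormalizer

/-- The cyclotomic field `ℚ(ζ_d)` inside `ℂ`, generated by `ζ_d = exp(2πi/d)`. -/
def cyclotomicSubfield (d : ℕ) : IntermediateField ℚ ℂ :=
  IntermediateField.adjoin ℚ {Complex.exp (2 * Real.pi * Complex.I / d)}

end

/-! Evaluating `χ_V` on `Λ^[m]` gives `ν_m(g, η) = |C|⁻¹ ∑_{c ∈ C} a(g, c) η(c)` with `C = C_G(g)`
and `a(g, z)` the number of `y` with `y ^ m = z = (y g) ^ m` (`doubleIndicator_eq`).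

Let `t ∈ N_G^d(g)` and `e = exp(G)`. By Dirichlet there is a prime `p > |G|` with `t⁻¹ g t = g ^ p`
and `p ≡ 1 mod d`. The embedding `σ : ζ_e ↦ ζ_e ^ p` fixes `ℚ(ζ_d)` and sends `η(c)` to `η(c ^ p)`,
so `ν_m(g, η) = |C|⁻¹ ∑ a(g, c) η(c ^ p)`. Conjugation by `t` gives `ν_m(g, t • η) = |C|⁻¹ ∑ a(g ^
p, c) η(c)`. The two sums agree after the substitution `c ↦ c ^ p` because `a(g ^ p, z ^ p) = a(g,
z)` (`rootCount_pow`).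

This last identity is the heart of the proof. In `𝔽_p[H]` with `p > |H|`, the `p`-th power of a
conjugation-invariant sum of group elements is the sum of their `p`-th powers (`sum_of_pow_prime`).
Applied in `H = C_G(z)` to the `m`-th roots of `z`, it gives equality of the counts mod `p`, and
both are below `p`.

The equivalence of the two properties comes from averaging over `N_G^d(g)`: the sum of `ν_m(g, t •
η)` over `t` is determined by the induced character. -/

noncomputable section

/-! ### Sweedler powers of the integral of `D(G)` -/

section SweedlerPowers

variable {G : Type*} [Group G] [Fintype G] [DecidableEq G]

namespace DrinfeldDouble

theorem convMul_of (f f' : WithConv (DrinfeldDouble G →ₗ[ℂ] DrinfeldDouble G)) (x y : G) :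
    (f * f').ofConv (of x y) = ∑ u : G, f.ofConv (of u y) * f'.ofConv (of (x * u⁻¹) y) := by
  rw [LinearMap.convMul_apply, comul_of]
  simp

/-- The iterated coproduct runs over factorizations `x = u_n ⋯ u_1`, and the product of the `e_{u_i}
⋈ y` vanishes unless `u_i = y u_{i+1} y⁻¹` throughout. Thus `w = u_1` determines all factors, and `x
= y⁻ⁿ (y w)ⁿ`. -/
theorem id_convPow_of (n : ℕ) (x y : G) :
    (WithConv.toConv (LinearMap.id : DrinfeldDouble G →ₗ[ℂ] DrinfeldDouble G) ^ n).ofConv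
      (of x y) = ∑ w : G, if (y * w) ^ n = y ^ n * x then of w (y ^ n) else 0 := by
  induction n generalizing x with
  | zero =>
    rw [pow_zero, LinearMap.convOne_apply, counit_of]
    by_cases hx : x = 1
    · simp [hx, one_eq_sum]
    · simp [hx, Ne.symm hx]
  | succ n ih =>
    rw [pow_succ, convMul_of]
    simp only [ih, LinearMap.id_apply, Finset.sum_mul, ite_mul, zero_mul,
      of_mul_of]
    rw [Finset.sum_comm]
    refine Finset.sum_congr rfl fun w _ => ?_
    -- The inductive condition `(y w)ⁿ = yⁿ u` leaves only this `u`.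
    rw [Finset.sum_eq_single ((y ^ n)⁻¹ * (y * w) ^ n)]
    · have h : w = y ^ n * (x * ((y ^ n)⁻¹ * (y * w) ^ n)⁻¹) * (y ^ n)⁻¹ ↔
          (y * w) ^ (n + 1) = y ^ (n + 1) * x := by
        have : y ^ n * (x * ((y ^ n)⁻¹ * (y * w) ^ n)⁻¹) * (y ^ n)⁻¹ =
            y⁻¹ * (y ^ (n + 1) * x) * ((y * w) ^ n)⁻¹ := by
          rw [pow_succ']; group
        rw [this, eq_mul_inv_iff_mul_eq, eq_inv_mul_iff_mul_eq, ← mul_assoc, ← pow_succ']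
      simp only [h, mul_inv_cancel_left, if_true, pow_succ y n]
    · intro u _ hu
      rw [if_neg]
      intro h
      exact hu (by rw [h]; group)
    · simp

/-- Same mechanism, with `w` the index of the first antipode factor. At `x = 1`, the only case
needed for the integral, the condition on `w` is the one for powers of the identity, so a single
formula covers all integers `m`. -/
theorem antipode_convPow_of (n : ℕ) (x y : G) :
    (WithConv.toConv (HopfAlgebra.antipode ℂ : DrinfeldDouble G →ₗ[ℂ] DrinfeldDouble G) ^
      n).ofConv (of x y) =
      ∑ w : G, if (y * w) ^ n = x⁻¹ * y ^ n then of w (y ^ n)⁻¹ else 0 := by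
  induction n generalizing x with
  | zero =>
    rw [pow_zero, LinearMap.convOne_apply, counit_of]
    by_cases hx : x = 1
    · simp [hx, one_eq_sum]
    · simp [hx, eq_comm (a := (1 : G))]
  | succ n ih =>
    rw [pow_succ, convMul_of]
    simp only [ih, antipode_of, Finset.sum_mul, ite_mul, zero_mul,
      of_mul_of]
    rw [Finset.sum_comm]
    refine Finset.sum_congr rfl fun w _ => ?_
    rw [Finset.sum_eq_single (y ^ n * ((y * w) ^ n)⁻¹)]
    · have h : w = (y ^ n)⁻¹ * (y⁻¹ * (x * (y ^ n * ((y * w) ^ n)⁻¹)⁻¹)⁻¹ * y) * (y ^ n)⁻¹⁻¹ ↔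
          (y * w) ^ (n + 1) = x⁻¹ * y ^ (n + 1) := by
        have : (y ^ n)⁻¹ * (y⁻¹ * (x * (y ^ n * ((y * w) ^ n)⁻¹)⁻¹)⁻¹ * y) * (y ^ n)⁻¹⁻¹ =
            y⁻¹ * (((y * w) ^ n)⁻¹ * (x⁻¹ * y ^ (n + 1))) := by
          rw [pow_succ']; group
        rw [this, eq_inv_mul_iff_mul_eq, eq_inv_mul_iff_mul_eq, ← pow_succ]
      have h' : (y ^ n)⁻¹ * y⁻¹ = (y ^ (n + 1))⁻¹ := by rw [pow_succ', mul_inv_rev]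
      have h'' : (y * w) ^ n = (y ^ n * ((y * w) ^ n)⁻¹)⁻¹ * y ^ n := by group
      rw [if_pos h'']
      simp only [h, h']
    · intro u _ hu
      rw [if_neg]
      intro h
      exact hu (by rw [h]; group)
    · simp

theorem sweedlerPower_integral (m : ℤ) :
    sweedlerPower ℂ m (integral G) = (Fintype.card G : ℂ)⁻¹ •
      ∑ y : G, ∑ w : G, if (y * w) ^ m = y ^ m then of w (y ^ m) else 0 := by
  cases m with
  | ofNat n =>
    simp only [sweedlerPower, integral, map_smul, map_sum, id_convPow_of]
    simp
  | negSucc n =>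
    simp only [sweedlerPower, integral, map_smul, map_sum, antipode_convPow_of]
    simp [zpow_negSucc]

end DrinfeldDouble

end SweedlerPowers

/-! ### Traces on spaces of functions -/

section Trace

theorem LinearMap.trace_pi_eq_sum {k ι V : Type*} [Field k] [Fintype ι] [DecidableEq ι]
    [AddCommGroup V] [Module k V] [FiniteDimensional k V] (L : (ι → V) →ₗ[k] (ι → V)) :
    LinearMap.trace k (ι → V) L =
      ∑ i, LinearMap.trace k V (LinearMap.proj i ∘ₗ L ∘ₗ LinearMap.single k (fun _ => V) i) := by
  have h : L = ∑ i, (L ∘ₗ LinearMap.single k (fun _ => V) i) ∘ₗ LinearMap.proj i := by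
    refine LinearMap.ext fun f => ?_
    conv_lhs => rw [← Finset.univ_sum_single f, map_sum]
    simp
  conv_lhs => rw [h]
  rw [map_sum]
  exact Finset.sum_congr rfl fun i _ => LinearMap.trace_comp_comm' _ _

end Trace

/-! ### The indicator as a sum of root counts times character values -/

section DoubleIndicator

variable {G : Type*} [Group G] [Fintype G] [DecidableEq G]

/-- The function `χ` on a subgroup, extended by zero. -/
def extendByZero {C : Subgroup G} (χ : C → ℂ) (x : G) : ℂ :=
  open scoped Classical in if h : x ∈ C then χ ⟨x, h⟩ else 0

theorem sum_ite_eq_extendByZero {C : Subgroup G} [Fintype C] (χ : C → ℂ) (x : G) :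
    ∑ c : C, (if (c : G) = x then χ c else 0) = extendByZero χ x := by
  unfold extendByZero
  split_ifs with h
  · rw [Finset.sum_eq_single ⟨x, h⟩]
    · simp
    · intro c _ hc
      rw [if_neg]
      rintro rfl
      exact hc rfl
    · simp
  · refine Finset.sum_eq_zero fun c _ => if_neg ?_
    rintro rfl
    exact h c.2

/-- The projection of the functions `G → W` onto `doubleModule g ρ` obtained by averaging. -/
def doubleModuleAverage (g : G) {W : Type*} [AddCommGroup W] [Module ℂ W]
    (ρ : Representation ℂ (Subgroup.centralizer {g}) W) [Fintype (Subgroup.centralizer {g})] :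
    (G → W) →ₗ[ℂ] doubleModule g ρ where
  toFun f := ⟨fun t => (Fintype.card (Subgroup.centralizer {g}) : ℂ)⁻¹ •
      ∑ c : Subgroup.centralizer {g}, ρ c (f (t * c)), fun t c => by
    simp only [map_smul, map_sum]
    congr 1
    refine Fintype.sum_equiv (Equiv.mulLeft c) _ _ fun c' => ?_
    rw [← Module.End.mul_apply, ← map_mul]
    simp [mul_assoc]⟩
  map_add' f f' := by
    ext t
    simp [Finset.sum_add_distrib]
  map_smul' a f := by
    ext t
    simp [← Finset.smul_sum, smul_comm a]

theorem doubleModuleAverage_apply_coe (g : G) {W : Type*} [AddCommGroup W] [Module ℂ W]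
    (ρ : Representation ℂ (Subgroup.centralizer {g}) W) [Fintype (Subgroup.centralizer {g})]
    (f : doubleModule g ρ) : doubleModuleAverage g ρ f.1 = f := by
  ext t
  have h (c : Subgroup.centralizer {g}) : ρ c (f.1 (t * c)) = f.1 t := by
    rw [f.2 t c, ← Module.End.mul_apply, ← map_mul]
    simp
  have : (Fintype.card (Subgroup.centralizer {g}) : ℂ) ≠ 0 := by
    exact_mod_cast Fintype.card_ne_zero
  simp only [doubleModuleAverage, LinearMap.coe_mk, AddHom.coe_mk, h, Finset.sum_const,
    Finset.card_univ]
  rw [← Nat.cast_smul_eq_nsmul ℂ, smul_smul, inv_mul_cancel₀ this, one_smul]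

/-- Averaging over `C_G(g)` retracts `G → W` onto the module, so by cyclicity the trace can be taken
on all of `G → W`, where it is a sum of diagonal blocks. No coset representatives are needed. -/
theorem trace_doubleRep_of (g : G) {W : Type*} [AddCommGroup W] [Module ℂ W]
    [FiniteDimensional ℂ W] (ρ : Representation ℂ (Subgroup.centralizer {g}) W)
    [Fintype (Subgroup.centralizer {g})] (w z : G) :
    LinearMap.trace ℂ _ (doubleRep g ρ (DrinfeldDouble.of w z)) =
      (Fintype.card (Subgroup.centralizer {g}) : ℂ)⁻¹ *
        ∑ t : G, if t * g * t⁻¹ = w then extendByZero ρ.character (t⁻¹ * z * t) else 0 := by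
  let S : (G → W) →ₗ[ℂ] (G → W) :=
    { toFun := fun f t => if t * g * t⁻¹ = w then f (z⁻¹ * t) else 0
      map_add' := fun f f' => by ext t; simp; split_ifs <;> simp
      map_smul' := fun a f => by ext t; simp }
  have h1 : doubleRep g ρ (DrinfeldDouble.of w z) =
      doubleModuleAverage g ρ ∘ₗ (S ∘ₗ (doubleModule g ρ).subtype) := by
    refine LinearMap.ext fun f => ?_
    rw [← doubleModuleAverage_apply_coe g ρ (doubleRep g ρ (DrinfeldDouble.of w z) f)]
    refine congrArg (doubleModuleAverage g ρ) (funext fun t => ?_)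
    rw [doubleRep_of]
    rfl
  rw [h1, LinearMap.trace_comp_comm', LinearMap.comp_assoc, LinearMap.trace_pi_eq_sum,
    Finset.mul_sum]
  refine Finset.sum_congr rfl fun t _ => ?_
  by_cases ht : t * g * t⁻¹ = w
  · rw [if_pos ht, ← sum_ite_eq_extendByZero]
    have : LinearMap.proj t ∘ₗ (S ∘ₗ (doubleModule g ρ).subtype ∘ₗ doubleModuleAverage g ρ) ∘ₗ
        LinearMap.single ℂ (fun _ => W) t =
        (Fintype.card (Subgroup.centralizer {g}) : ℂ)⁻¹ •
          ∑ c : Subgroup.centralizer {g}, if (c : G) = t⁻¹ * z * t then ρ c else 0 := by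
      refine LinearMap.ext fun v => ?_
      simp only [LinearMap.comp_apply, LinearMap.proj_apply, S, LinearMap.coe_mk, AddHom.coe_mk,
        if_pos ht, doubleModuleAverage, Submodule.subtype_apply, LinearMap.smul_apply,
        LinearMap.sum_apply]
      congr 1
      refine Finset.sum_congr rfl fun c _ => ?_
      -- The average of a function supported at `t`, evaluated at `z⁻¹ t`, receives a contribution
      -- only from these `c`.
      have hc : z⁻¹ * t * c = t ↔ (c : G) = t⁻¹ * z * t := by
        rw [← eq_inv_mul_iff_mul_eq]
        simp [mul_assoc]
      by_cases h : (c : G) = t⁻¹ * z * t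
      · rw [if_pos h, hc.mpr h]
        simp
      · rw [if_neg h]
        simp [mt hc.mp h]
    rw [this, map_smul, map_sum, smul_eq_mul]
    congr 1
    refine Finset.sum_congr rfl fun c _ => ?_
    split_ifs
    · rfl
    · simp
  · rw [if_neg ht, mul_zero]
    have : LinearMap.proj t ∘ₗ (S ∘ₗ (doubleModule g ρ).subtype ∘ₗ doubleModuleAverage g ρ) ∘ₗ
        LinearMap.single ℂ (fun _ => W) t = 0 := by
      refine LinearMap.ext fun v => ?_
      simp [S, ht]
    rw [this, map_zero]

/-- The number of `y` with `y ^ m = z = (y g) ^ m`. -/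
def rootCount (m : ℤ) (g z : G) : ℕ :=
  (Finset.univ.filter fun y : G => y ^ m = z ∧ (y * g) ^ m = z).card

theorem rootCount_conj (m : ℤ) (t g z : G) :
    rootCount m (t * g * t⁻¹) (t * z * t⁻¹) = rootCount m g z := by
  refine (Finset.card_equiv (MulAut.conj t).toEquiv fun y => ?_).symm
  have h : t * y * t⁻¹ * (t * g * t⁻¹) = t * (y * g) * t⁻¹ := by group
  simp [h, conj_zpow]

/-- Both `y` and `y g` commute with their common power `z`, hence so does `g`. -/
theorem mem_centralizer_of_rootCount_ne_zero {m : ℤ} {g z : G} (h : rootCount m g z ≠ 0) :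
    g ∈ Subgroup.centralizer {z} := by
  obtain ⟨y, hy⟩ := Finset.card_ne_zero.mp h
  obtain ⟨-, h1, h2⟩ := Finset.mem_filter.mp hy
  have hy : y ∈ Subgroup.centralizer {z} := by
    rw [Subgroup.mem_centralizer_singleton_iff, ← h1]
    exact (Commute.refl y).zpow_right m
  have hyg : y * g ∈ Subgroup.centralizer {z} := by
    rw [Subgroup.mem_centralizer_singleton_iff, ← h2]
    exact (Commute.refl (y * g)).zpow_right m
  simpa using mul_mem (inv_mem hy) hyg

/-- The sum over `w` collapses to `w = t g t⁻¹`. Replacing `y` by its conjugate under `t` then makes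
all summands over `t` equal, and the resulting factor `|G|` cancels the normalization of the
integral. -/
theorem doubleIndicator_eq (m : ℤ) (g : G) (η : IrrChar (Subgroup.centralizer {g}))
    [Fintype (Subgroup.centralizer {g})] :
    doubleIndicator m g η = (Fintype.card (Subgroup.centralizer {g}) : ℂ)⁻¹ *
      ∑ c : Subgroup.centralizer {g}, rootCount m g c * η c := by
  have hG : (Fintype.card G : ℂ) ≠ 0 := by exact_mod_cast Fintype.card_ne_zero
  have h1 (t : G) : (∑ y : G, if (y * (t * g * t⁻¹)) ^ m = y ^ m then
      extendByZero η (t⁻¹ * y ^ m * t) else 0) =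
      ∑ y : G, if (y * g) ^ m = y ^ m then extendByZero η (y ^ m) else 0 := by
    refine (Fintype.sum_equiv (MulAut.conj t).toEquiv _ _ fun y => ?_).symm
    have h : t * y * t⁻¹ * (t * g * t⁻¹) = t * (y * g) * t⁻¹ := by group
    have h' : t⁻¹ * (t * y ^ m * t⁻¹) * t = y ^ m := by group
    simp [h, conj_zpow, h']
  have h2 : (∑ y : G, if (y * g) ^ m = y ^ m then extendByZero η (y ^ m) else 0) =
      ∑ c : Subgroup.centralizer {g}, (rootCount m g c : ℂ) * η c := by
    simp only [rootCount, Finset.card_filter, Nat.cast_sum, Finset.sum_mul]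
    rw [Finset.sum_comm]
    refine Finset.sum_congr rfl fun y _ => ?_
    rw [← sum_ite_eq_extendByZero]
    split_ifs with hy
    · refine Finset.sum_congr rfl fun c _ => ?_
      simp [hy, eq_comm (a := (c : G))]
    · refine (Finset.sum_eq_zero fun c _ => ?_).symm
      rw [if_neg]
      · simp
      · rintro ⟨h, h'⟩
        exact hy (h'.trans h.symm)
  rw [doubleIndicator, frobeniusSchurIndicator, DrinfeldDouble.sweedlerPower_integral]
  simp only [map_smul, map_sum, apply_ite (doubleRep g η.rep), map_zero,
    apply_ite (LinearMap.trace ℂ _), trace_doubleRep_of, η.rep_character, smul_eq_mul]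
  have h3 (y : G) : (∑ w : G, if (y * w) ^ m = y ^ m then
      (Fintype.card (Subgroup.centralizer {g}) : ℂ)⁻¹ * ∑ t : G, (if t * g * t⁻¹ = w then
        extendByZero η (t⁻¹ * y ^ m * t) else 0) else 0) =
      (Fintype.card (Subgroup.centralizer {g}) : ℂ)⁻¹ * ∑ t : G,
        if (y * (t * g * t⁻¹)) ^ m = y ^ m then extendByZero η (t⁻¹ * y ^ m * t) else 0 := by
    have (w : G) : (if (y * w) ^ m = y ^ m then
        (Fintype.card (Subgroup.centralizer {g}) : ℂ)⁻¹ * ∑ t : G, (if t * g * t⁻¹ = w then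
          extendByZero η (t⁻¹ * y ^ m * t) else 0) else 0) =
        (Fintype.card (Subgroup.centralizer {g}) : ℂ)⁻¹ * ∑ t : G, if t * g * t⁻¹ = w then
          (if (y * (t * g * t⁻¹)) ^ m = y ^ m then extendByZero η (t⁻¹ * y ^ m * t) else 0)
          else 0 := by
      split_ifs with h
      · congr 1
        refine Finset.sum_congr rfl fun t _ => ?_
        split_ifs with ht h'
        · rfl
        · exact absurd (ht.symm ▸ h) h'
        · rfl
      · rw [Finset.sum_eq_zero, mul_zero]
        intro t _
        split_ifs with ht h'
        · exact absurd (ht ▸ h') h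
        · rfl
        · rfl
    simp only [this, ← Finset.mul_sum]
    rw [Finset.sum_comm]
    simp
  simp only [h3, ← Finset.mul_sum]
  rw [Finset.sum_comm]
  simp only [h1, h2, Finset.sum_const, Finset.card_univ, nsmul_eq_mul]
  field_simp

end DoubleIndicator

/-! ### The character of an induced representation -/

section InducedCharacter

open scoped MonoidAlgebra
open Representation

variable {A B : Type*} [Group A] [Group B] [Fintype A] [Fintype B] [DecidableEq B]
  {V : Type*} [AddCommGroup V] [Module ℂ V] [FiniteDimensional ℂ V]

theorem trace_mapDomain (f : B → B) :
    LinearMap.trace ℂ ℂ[B] (MonoidAlgebra.mapDomainLinearMap ℂ ℂ f) =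
      ∑ x : B, if f x = x then 1 else 0 := by
  rw [LinearMap.trace_eq_matrix_trace ℂ (MonoidAlgebra.basis B ℂ), Matrix.trace]
  refine Finset.sum_congr rfl fun x _ => ?_
  rw [Matrix.diag_apply, LinearMap.toMatrix_apply, MonoidAlgebra.basis_apply,
    MonoidAlgebra.mapDomainLinearMap_single]
  change (MonoidAlgebra.single (f x) (1 : ℂ)).coeff x = _
  simp [Finsupp.single_apply]

/-- The induced representation is the space of `A`-coinvariants of `ℂ[B] ⊗ V`, and averaging over
`A` gives a section `i` of the quotient map. The trace therefore moves to `ℂ[B] ⊗ V`, where the term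
of `c` is the tensor product of the permutation `x ↦ φ(c) x h⁻¹` with `ρ(c)`. -/
theorem character_ind (φ : A →* B) (ρ : Representation ℂ A V) (h : B) :
    (Representation.ind φ ρ).character h = (Fintype.card A : ℂ)⁻¹ *
      ∑ c : A, ∑ x : B, if φ c = x * h * x⁻¹ then ρ.character c else 0 := by
  let τ := Representation.tprod ((leftRegular ℂ B).comp φ) ρ
  let S := (MonoidAlgebra.mapDomainLinearMap ℂ ℂ fun x : B => x * h⁻¹).rTensor V
  let i : Coinvariants τ →ₗ[ℂ] ℂ[B] ⊗[ℂ] V :=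
    Coinvariants.lift τ ((Fintype.card A : ℂ)⁻¹ • ∑ c : A, τ c) fun a => by
      rw [LinearMap.smul_comp]
      congr 1
      refine LinearMap.ext fun v => ?_
      simp only [LinearMap.comp_apply, LinearMap.sum_apply]
      refine Fintype.sum_equiv (Equiv.mulRight a) _ _ fun c => ?_
      rw [Equiv.coe_mulRight, map_mul]
      rfl
  have hi : Coinvariants.mk τ ∘ₗ i = LinearMap.id := by
    refine Coinvariants.hom_ext (LinearMap.ext fun v => ?_)
    have hA : (Fintype.card A : ℂ) ≠ 0 := by exact_mod_cast Fintype.card_ne_zero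
    simp only [i, LinearMap.comp_apply, Coinvariants.lift_mk, LinearMap.smul_apply,
      LinearMap.sum_apply, map_smul, map_sum, Coinvariants.mk_self_apply, Finset.sum_const,
      Finset.card_univ, LinearMap.id_apply]
    rw [← Nat.cast_smul_eq_nsmul ℂ, smul_smul, inv_mul_cancel₀ hA, one_smul]
  have hT : Representation.ind φ ρ h = Coinvariants.mk τ ∘ₗ (S ∘ₗ i) := by
    have h : Coinvariants.mk τ ∘ₗ S = Representation.ind φ ρ h ∘ₗ Coinvariants.mk τ := rfl
    rw [← LinearMap.comp_assoc, h, LinearMap.comp_assoc, hi, LinearMap.comp_id]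
  have hA : i ∘ₗ Coinvariants.mk τ = (Fintype.card A : ℂ)⁻¹ • ∑ c : A, τ c := rfl
  rw [Representation.character, hT, LinearMap.trace_comp_comm', LinearMap.comp_assoc, hA,
    LinearMap.comp_smul, map_smul, smul_eq_mul, ← Module.End.mul_eq_comp, Finset.mul_sum, map_sum]
  congr 1
  refine Finset.sum_congr rfl fun c _ => ?_
  have hc : S * τ c = TensorProduct.map
      (MonoidAlgebra.mapDomainLinearMap ℂ ℂ fun x : B => φ c * x * h⁻¹) (ρ c) := by
    refine TensorProduct.ext (MonoidAlgebra.lhom_ext' fun x => LinearMap.ext_ring ?_)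
    ext v
    simp [S, τ]
  rw [hc, LinearMap.trace_tensorProduct', trace_mapDomain, Finset.sum_mul]
  refine Finset.sum_congr rfl fun x _ => ?_
  have hx : φ c * x * h⁻¹ = x ↔ φ c = x * h * x⁻¹ := by
    rw [mul_inv_eq_iff_eq_mul, eq_mul_inv_iff_mul_eq]
  simp only [hx, ite_mul, one_mul, zero_mul]
  rfl

end InducedCharacter

/-! ### `p`-th powers of central elements in the group algebra over `𝔽_p` -/

section PowerMap

open scoped MonoidAlgebra

/-- The expansion keeps words, since the `f i` need not commute; cyclic rotation will act on them.
-/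
theorem sum_pow_eq_sum_vector {R I : Type*} [Semiring R] [Fintype I] (f : I → R) (n : ℕ) :
    (∑ i, f i) ^ n = ∑ v : List.Vector I n, (v.toList.map f).prod := by
  induction n with
  | zero =>
    rw [pow_zero, Fintype.sum_subsingleton _ List.Vector.nil]
    simp
  | succ n ih =>
    rw [pow_succ', ih, Finset.sum_mul_sum, ← Finset.sum_product',
      Finset.univ_product_univ]
    refine Fintype.sum_bijective (fun q : I × List.Vector I n => q.1 ::ᵥ q.2) ?_ _ _ fun q => ?_
    · refine ⟨fun q q' h => ?_, fun v => ⟨(v.head, v.tail), List.Vector.cons_head_tail v⟩⟩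
      have h1 := congrArg List.Vector.head h
      have h2 := congrArg List.Vector.tail h
      exact Prod.ext (by simpa using h1) (by simpa using h2)
    · simp

theorem isConj_prod_rotate {H : Type*} [Group H] (l : List H) (n : ℕ) :
    IsConj l.prod (l.rotate n).prod := by
  induction n with
  | zero => rw [List.rotate_zero]
  | succ n ih =>
    refine ih.trans ?_
    rw [← List.rotate_rotate]
    cases l.rotate n with
    | nil => simp
    | cons x xs =>
      rw [List.rotate_cons_succ, List.rotate_zero, List.prod_append, List.prod_cons,
        List.prod_singleton, isConj_iff]
      exact ⟨x⁻¹, by group⟩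

variable {H : Type*} [Group H]

/-- Rotation of words preserves the conjugacy class of the product and has order dividing `p`. Its
fixed points are the constant words, and all other orbits have `p` elements. -/
theorem card_isConj_prod_modEq {I : Type*} [Finite I] (p : ℕ) [Fact p.Prime] (φ : I → H) (k : H) :
    Nat.card {v : List.Vector I p // IsConj k (v.toList.map φ).prod} ≡
      Nat.card {i : I // IsConj k (φ i ^ p)} [MOD p] := by
  classical
  have := Fintype.ofFinite I
  let α := {v : List.Vector I p // IsConj k (v.toList.map φ).prod}
  have : Fintype α := Fintype.ofFinite α
  let r (n : ℕ) : Function.End α := fun v =>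
    ⟨⟨v.1.toList.rotate n, by simp⟩, v.2.trans (by
      change IsConj (v.1.toList.map φ).prod ((v.1.toList.rotate n).map φ).prod
      rw [List.map_rotate]
      exact isConj_prod_rotate _ n)⟩
  have hr (n : ℕ) : r 1 ^ n = r n := by
    induction n with
    | zero =>
      funext v
      exact Subtype.ext (Subtype.ext (List.rotate_zero _).symm)
    | succ n ih =>
      rw [pow_succ', ih]
      funext v
      exact Subtype.ext (Subtype.ext (List.rotate_rotate _ n 1))
  have hr1 : r 1 ^ p ^ 1 = 1 := by
    rw [pow_one, hr]
    funext v
    refine Subtype.ext (Subtype.ext ?_)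
    have h := List.rotate_length v.1.toList
    rwa [List.Vector.toList_length] at h
  have h := Equiv.Perm.card_fixedPoints_modEq hr1
  rw [← Nat.card_eq_fintype_card, ← Nat.card_eq_fintype_card] at h
  refine h.trans (Nat.ModEq.symm (congrArg (· % p) (Nat.card_congr ?_)))
  refine Equiv.ofBijective (fun i => ⟨⟨List.Vector.replicate p i.1, by
    simpa [List.Vector.replicate, List.Vector.toList] using i.2⟩, ?_⟩)
    ⟨fun i j hij => ?_, fun v => ?_⟩
  · exact Subtype.ext (Subtype.ext (List.rotate_replicate i.1 p 1))
  · have h1 := congrArg (fun v => v.1.1.toList) hij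
    exact Subtype.ext ((List.replicate_right_injective (Fact.out : p.Prime).ne_zero) h1)
  · have : Nonempty I := ⟨v.1.1.get ⟨0, (Fact.out : p.Prime).pos⟩⟩
    obtain ⟨i, hi⟩ := List.rotate_one_eq_self_iff_eq_replicate.mp
      (congrArg (fun v => v.1.toList) v.2)
    rw [List.Vector.toList_length] at hi
    refine ⟨⟨i, ?_⟩, Subtype.ext (Subtype.ext (Subtype.ext hi.symm))⟩
    have h1 := v.1.2
    rw [hi] at h1
    simpa using h1

/-- The sum of the coefficients over the conjugacy class of `k`. -/
def classSum (R : Type*) [CommSemiring R] [Fintype H] (k : H) : R[H] →ₗ[R] R :=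
  open scoped Classical in
  ∑ h : H, if IsConj k h then
    Finsupp.lapply h ∘ₗ (MonoidAlgebra.coeffLinearEquiv R).toLinearMap else 0

theorem classSum_of (R : Type*) [CommSemiring R] [Fintype H] (k h : H)
    [Decidable (IsConj k h)] :
    classSum R k (MonoidAlgebra.of R H h) = if IsConj k h then 1 else 0 := by
  classical
  rw [classSum, LinearMap.sum_apply, Finset.sum_eq_single h]
  · split_ifs <;> simp
  · intro b _ hb
    split_ifs <;> simp [hb.symm]
  · simp

/-- A central element has constant coefficients on each class, so the class sum recovers the
coefficient once the class size is invertible. -/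
theorem classSum_of_central (R : Type*) [CommSemiring R] [Fintype H] (k : H) (x : R[H])
    (hx : ∀ h : H, Commute (MonoidAlgebra.of R H h) x) :
    classSum R k x = (Nat.card {h // IsConj k h} : R) * x.coeff k := by
  classical
  rw [classSum, LinearMap.sum_apply, Nat.card_eq_fintype_card, Fintype.card_subtype,
    Finset.card_filter, Nat.cast_sum, Finset.sum_mul]
  refine Finset.sum_congr rfl fun h _ => ?_
  split_ifs with hk
  · obtain ⟨c, rfl⟩ := isConj_iff.mp hk
    have h1 := congrArg (fun y => y.coeff (c * k)) (hx c).eq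
    simpa using h1.symm
  · simp

/-- An indexed family instead of a subset allows repetitions, which occur for products such as `a⁻¹
b`. -/
theorem commute_of_sum_of (R : Type*) [CommSemiring R] {I : Type*} [Fintype I] (φ : I → H)
    (hφ : ∀ h : H, ∃ σ : Equiv.Perm I, ∀ i, φ (σ i) = h * φ i * h⁻¹) (h : H) :
    Commute (MonoidAlgebra.of R H h) (∑ i, MonoidAlgebra.of R H (φ i)) := by
  obtain ⟨σ, hσ⟩ := hφ h
  rw [Commute, SemiconjBy, Finset.mul_sum, Finset.sum_mul]
  refine Fintype.sum_equiv σ _ _ fun i => ?_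
  rw [hσ, ← map_mul, ← map_mul]
  simp

/-- Both sides are central, so it suffices to compare class sums. On these, the nonconstant words in
the expansion of the `p`-th power cancel mod `p` by rotation. -/
theorem sum_of_pow_prime [Fintype H] {I : Type*} [Fintype I] (p : ℕ) [Fact p.Prime]
    (hp : Fintype.card H < p) (φ : I → H)
    (hφ : ∀ h : H, ∃ σ : Equiv.Perm I, ∀ i, φ (σ i) = h * φ i * h⁻¹) :
    (∑ i, MonoidAlgebra.of (ZMod p) H (φ i)) ^ p = ∑ i, MonoidAlgebra.of (ZMod p) H (φ i ^ p) := by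
  classical
  have h1 := fun h => (commute_of_sum_of (ZMod p) φ hφ h).pow_right p
  have h2 := commute_of_sum_of (ZMod p) (fun i => φ i ^ p) fun h => (hφ h).imp fun σ hσ i => by
    rw [hσ, conj_pow]
  ext k
  -- The class size lies between `1` and `|H| < p`.
  have hk : ((Nat.card {h // IsConj k h} : ℕ) : ZMod p) ≠ 0 := by
    rw [Ne, ZMod.natCast_eq_zero_iff]
    refine fun h => absurd (Nat.le_of_dvd ?_ h) (not_le.mpr (lt_of_le_of_lt ?_ hp))
    · have : Nonempty {h // IsConj k h} := ⟨k, IsConj.refl k⟩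
      exact Nat.card_pos
    · rw [Nat.card_eq_fintype_card]
      exact Fintype.card_subtype_le _
  refine mul_left_cancel₀ hk ?_
  rw [← classSum_of_central _ _ _ h1, ← classSum_of_central _ _ _ h2, sum_pow_eq_sum_vector]
  have h3 (v : List.Vector I p) : (v.toList.map fun i => MonoidAlgebra.of (ZMod p) H (φ i)).prod =
      MonoidAlgebra.of (ZMod p) H (v.toList.map φ).prod := by
    rw [map_list_prod, List.map_map]
    rfl
  simp only [h3, map_sum, classSum_of]
  have h4 := (ZMod.natCast_eq_natCast_iff _ _ _).mpr (card_isConj_prod_modEq p φ k)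
  rw [Nat.card_eq_fintype_card, Nat.card_eq_fintype_card, Fintype.card_subtype,
    Fintype.card_subtype] at h4
  simpa using h4

/-- The first count is the number of pairs with `a⁻¹ b = g`, the second of those with `a⁻ᵖ bᵖ = gᵖ`.
Mod `p`, both are the coefficient at `g ^ p` of `((∑ a⁻¹)(∑ b)) ^ p`, computed from the family `a⁻¹
b` or from the two commuting factors. -/
theorem card_filter_mul_mem (p : ℕ) [Fact p.Prime] [Fintype H] [DecidableEq H]
    (hp : Fintype.card H < p) (A B : Finset H) (hA : ∀ h, ∀ a ∈ A, h * a * h⁻¹ ∈ A)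
    (hB : ∀ h, ∀ b ∈ B, h * b * h⁻¹ ∈ B) (g : H) :
    (A.filter fun a => a * g ∈ B).card =
      (A.filter fun a => a ^ p * g ^ p ∈ B.image (· ^ p)).card := by
  have hcop : (Nat.card H).Coprime p := by
    rw [Nat.card_eq_fintype_card]
    exact (((Fact.out : p.Prime).coprime_iff_not_dvd).mpr fun h =>
      absurd (Nat.le_of_dvd Fintype.card_pos h) (not_le.mpr hp)).symm
  have hinj : Function.Injective fun h : H => h ^ p := (powCoprime hcop).injective
  have hperm (C : Finset H) (hC : ∀ h, ∀ a ∈ C, h * a * h⁻¹ ∈ C) (h : H) :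
      ∃ σ : Equiv.Perm C, ∀ a, (σ a : H) = h * a * h⁻¹ :=
    ⟨⟨fun a => ⟨h * a * h⁻¹, hC h a a.2⟩,
      fun a => ⟨h⁻¹ * a * h, by simpa using hC h⁻¹ a a.2⟩,
      fun a => Subtype.ext (by simp [mul_assoc]), fun a => Subtype.ext (by simp [mul_assoc])⟩,
      fun a => rfl⟩
  have hA' (h : H) : ∃ σ : Equiv.Perm A, ∀ a, ((σ a : H))⁻¹ = h * (a : H)⁻¹ * h⁻¹ :=
    (hperm A hA h).imp fun σ hσ a => by rw [hσ]; group
  have h1 := sum_of_pow_prime p hp (fun a : A => (a : H)⁻¹) hA'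
  have h2 := sum_of_pow_prime p hp (fun b : B => (b : H)) (hperm B hB)
  have h3 := sum_of_pow_prime p hp (fun q : A × B => (q.1 : H)⁻¹ * q.2) fun h => by
    obtain ⟨σ, hσ⟩ := hperm A hA h
    obtain ⟨τ, hτ⟩ := hperm B hB h
    refine ⟨Equiv.prodCongr σ τ, fun q => ?_⟩
    simp only [Equiv.prodCongr_apply, Prod.map, hσ, hτ]
    group
  have hcomm : Commute (∑ a : A, MonoidAlgebra.of (ZMod p) H (a : H)⁻¹)
      (∑ b : B, MonoidAlgebra.of (ZMod p) H (b : H)) :=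
    Commute.sum_left _ _ _ fun a _ => commute_of_sum_of (ZMod p) _ (hperm B hB) _
  have h4 := hcomm.mul_pow p
  rw [h1, h2] at h4
  simp only [Finset.sum_mul_sum, ← map_mul] at h4
  rw [← Fintype.sum_prod_type', h3] at h4
  have h5 := congrArg (fun y => y.coeff (g ^ p)) h4
  have hcount (f f' : H → H) (hf : Function.Injective f) (k : H) :
      ((A.filter fun a => f' a * k ∈ B.image f).card : ZMod p) =
        ∑ a : A, ∑ b : B, if (f' a)⁻¹ * f b = k then 1 else 0 := by
    rw [Finset.card_filter, Nat.cast_sum, ← Finset.sum_coe_sort]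
    refine Finset.sum_congr rfl fun a _ => ?_
    simp only [inv_mul_eq_iff_eq_mul]
    by_cases h : f' a * k ∈ B.image f
    · rw [if_pos h, Nat.cast_one]
      obtain ⟨b, hb, h⟩ := Finset.mem_image.mp h
      rw [Finset.sum_eq_single ⟨b, hb⟩]
      · rw [if_pos h]
      · intro b' _ hb'
        rw [if_neg]
        intro h'
        exact hb' (Subtype.ext (hf (h'.trans h.symm)))
      · simp
    · rw [if_neg h, Nat.cast_zero, Finset.sum_eq_zero]
      intro b _
      rw [if_neg]
      intro h'
      exact h (Finset.mem_image.mpr ⟨b, b.2, h'⟩)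
  have hlt (P : H → Prop) [DecidablePred P] : (A.filter P).card < p :=
    (Finset.card_le_univ _).trans_lt hp
  -- Both counts are at most `|H| < p`, so congruence mod `p` is equality.
  refine Nat.ModEq.eq_of_lt_of_lt ((ZMod.natCast_eq_natCast_iff _ _ _).mp ?_) (hlt _) (hlt _)
  have h6 := hcount id id Function.injective_id g
  have h7 := hcount (· ^ p) (· ^ p) hinj (g ^ p)
  simp only [Finset.image_id, id] at h6
  rw [h6, h7]
  simp only [MonoidAlgebra.coeff_sum, Finsupp.finsetSum_apply, MonoidAlgebra.of_apply,
    MonoidAlgebra.coeff_single, Finsupp.single_apply, Fintype.sum_prod_type, inv_pow,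
    hinj.eq_iff] at h5
  exact h5

end PowerMap

/-! ### Root counts under the `p`-th power map -/

section RootCountPower

variable {G : Type*} [Group G] [Fintype G] [DecidableEq G]

theorem card_filter_subgroup (C : Subgroup G) [Fintype C] (P : G → Prop) [DecidablePred P]
    (hP : ∀ x, P x → x ∈ C) :
    (Finset.univ.filter fun x : C => P x).card = (Finset.univ.filter P).card := by
  refine Finset.card_bij (fun x _ => (x : G)) ?_ ?_ ?_
  · simp
  · intro x _ y _ h
    exact Subtype.ext h
  · intro x hx
    have hx := (Finset.mem_filter.mp hx).2
    exact ⟨⟨x, hP x hx⟩, by simpa using hx, rfl⟩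

/-- All `m`-th roots of `z` lie in `C_G(z)` and form a conjugation-stable subset there, so
`card_filter_mul_mem` applies when `g ∈ C_G(z)`. Otherwise both counts vanish, as the bijective map
`x ↦ x ^ p` reflects commutation. -/
theorem rootCount_pow (p : ℕ) [Fact p.Prime] (hp : Fintype.card G < p) (m : ℤ) (g z : G) :
    rootCount m (g ^ p) (z ^ p) = rootCount m g z := by
  classical
  have hcop : (Nat.card G).Coprime p := by
    rw [Nat.card_eq_fintype_card]
    exact (((Fact.out : p.Prime).coprime_iff_not_dvd).mpr fun h =>
      absurd (Nat.le_of_dvd Fintype.card_pos h) (not_le.mpr hp)).symm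
  have hbij : Function.Bijective fun x : G => x ^ p := (powCoprime hcop).bijective
  have hcent (x y : G) (h : Commute (x ^ p) (y ^ p)) : Commute x y := by
    have h1 (a b : G) (hab : Commute (a ^ p) b) : Commute a b := by
      have h2 : (b * a * b⁻¹) ^ p = a ^ p := by
        rw [conj_pow, ← hab.eq, mul_inv_cancel_right]
      exact (mul_inv_eq_iff_eq_mul.mp (hbij.1 h2)).symm
    exact (h1 y x (h1 x (y ^ p) h).symm).symm
  by_cases hg : g ∈ Subgroup.centralizer {z}
  · have hC (y : G) (hy : y ^ m = z) : y ∈ Subgroup.centralizer {z} := by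
      rw [Subgroup.mem_centralizer_singleton_iff, ← hy]
      exact (Commute.refl y).zpow_right m
    let A : Finset (Subgroup.centralizer {z}) := Finset.univ.filter fun a => (a : G) ^ m = z
    have hA (h : Subgroup.centralizer {z}) : ∀ a ∈ A, h * a * h⁻¹ ∈ A := by
      intro a ha
      have ha : (a : G) ^ m = z := (Finset.mem_filter.mp ha).2
      refine Finset.mem_filter.mpr ⟨Finset.mem_univ _, ?_⟩
      change ((h : G) * a * (h : G)⁻¹) ^ m = z
      rw [conj_zpow, ha, mul_inv_eq_iff_eq_mul]
      exact Subgroup.mem_centralizer_singleton_iff.mp h.2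
    have key := card_filter_mul_mem p ((Fintype.card_subtype_le _).trans_lt hp) A A hA hA ⟨g, hg⟩
    have h1 : rootCount m g z = (A.filter fun a => a * ⟨g, hg⟩ ∈ A).card := by
      rw [rootCount, ← card_filter_subgroup (Subgroup.centralizer {z}) _ fun y hy => hC y hy.1,
        Finset.filter_filter]
      simp [A]
    have h2 : rootCount m (g ^ p) (z ^ p) =
        (A.filter fun a => a ^ p * ⟨g, hg⟩ ^ p ∈ A.image (· ^ p)).card := by
      -- The `m`-th roots of `z ^ p` are exactly the `p`-th powers of the `m`-th roots of `z`.
      have h3 : rootCount m (g ^ p) (z ^ p) =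
          (Finset.univ.filter fun y : G =>
            y ^ m = z ∧ ∃ b, b ^ m = z ∧ b ^ p = y ^ p * g ^ p).card := by
        refine (Finset.card_equiv (Equiv.ofBijective _ hbij) fun y => ?_).symm
        have hroot (y : G) : (y ^ p) ^ m = z ^ p ↔ y ^ m = z := by
          rw [← zpow_natCast, zpow_comm, zpow_natCast]
          exact hbij.1.eq_iff
        obtain ⟨c, hc⟩ := hbij.2 (y ^ p * g ^ p)
        simp only [Finset.mem_filter, Finset.mem_univ, true_and, Equiv.ofBijective_apply, hroot]
        simp only at hc
        rw [← hc, hroot]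
        refine and_congr_right fun _ => ⟨?_, fun h => ⟨c, h, rfl⟩⟩
        rintro ⟨b, hb, h⟩
        rwa [← hbij.1 h]
      rw [h3, ← card_filter_subgroup (Subgroup.centralizer {z}) _ fun y hy => hC y hy.1,
        Finset.filter_filter]
      refine congrArg _ (Finset.filter_congr fun y _ => and_congr_right fun _ => ?_)
      rw [Finset.mem_image]
      constructor
      · rintro ⟨b, hb, h⟩
        exact ⟨⟨b, hC b hb⟩, Finset.mem_filter.mpr ⟨Finset.mem_univ _, hb⟩, Subtype.ext h⟩
      · rintro ⟨b, hb, h⟩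
        exact ⟨b, (Finset.mem_filter.mp hb).2, congrArg Subtype.val h⟩
    rw [h1, h2, key]
  · have hg' : g ^ p ∉ Subgroup.centralizer {z ^ p} := fun h =>
      hg (Subgroup.mem_centralizer_singleton_iff.mpr
        (hcent g z (Subgroup.mem_centralizer_singleton_iff.mp h)))
    rw [not_imp_comm.mp mem_centralizer_of_rootCount_ne_zero hg,
      not_imp_comm.mp mem_centralizer_of_rootCount_ne_zero hg']

end RootCountPower

/-! ### Galois action on character values -/

section GaloisAction

/-- An endomorphism of finite order is diagonalizable because `X ^ e - 1` is squarefree. The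
multiplicities do not depend on `k`, so applying `μ ↦ μ ^ p` to the eigenvalues turns the trace of
`f` into that of `f ^ p`. -/
theorem exists_trace_pow_eq_sum {V : Type*} [AddCommGroup V] [Module ℂ V] [FiniteDimensional ℂ V]
    (f : Module.End ℂ V) {e : ℕ} (he : 0 < e) (hf : f ^ e = 1) :
    ∃ (s : Finset ℂ) (n : ℂ → ℕ), (∀ μ ∈ s, μ ^ e = 1) ∧
      ∀ k : ℕ, LinearMap.trace ℂ V (f ^ k) = ∑ μ ∈ s, n μ * μ ^ k := by
  have hss : f.IsSemisimple := by
    refine Module.End.isSemisimple_of_squarefree_aeval_eq_zero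
      (p := Polynomial.X ^ e - Polynomial.C 1)
      (Polynomial.separable_X_pow_sub_C 1 (by exact_mod_cast he.ne') one_ne_zero).squarefree ?_
    simp [hf]
  have hint : DirectSum.IsInternal f.eigenspace :=
    DirectSum.isInternal_submodule_of_iSupIndep_of_iSup_eq_top f.eigenspaces_iSupIndep
      hss.iSup_eigenspace_eq_top
  have hfin : {μ | f.eigenspace μ ≠ ⊥}.Finite := f.finite_hasEigenvalue
  refine ⟨hfin.toFinset, fun μ => Module.finrank ℂ (f.eigenspace μ), fun μ hμ => ?_, fun k => ?_⟩
  · obtain ⟨v, hv, hv0⟩ := Submodule.exists_mem_ne_zero_of_ne_bot (hfin.mem_toFinset.mp hμ)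
    have h := Module.End.HasEigenvector.pow_apply ⟨hv, hv0⟩ e
    rw [hf, Module.End.one_apply] at h
    exact (smul_left_injective ℂ hv0 (by simpa using h)).symm
  · have hpow (μ : ℂ) (v : V) (hv : v ∈ f.eigenspace μ) : (f ^ k) v = μ ^ k • v := by
      by_cases hv0 : v = 0
      · simp [hv0]
      · exact Module.End.HasEigenvector.pow_apply ⟨hv, hv0⟩ k
    have hmaps (μ : ℂ) : Set.MapsTo (f ^ k) (f.eigenspace μ) (f.eigenspace μ) := fun v hv => by
      rw [hpow μ v hv]
      exact Submodule.smul_mem _ _ hv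
    rw [LinearMap.trace_eq_sum_trace_restrict' hint hfin hmaps]
    refine Finset.sum_congr rfl fun μ _ => ?_
    have : (f ^ k).restrict (hmaps μ) = μ ^ k • LinearMap.id :=
      LinearMap.ext fun v => Subtype.ext (hpow μ v v.2)
    rw [this, map_smul, LinearMap.trace_id, smul_eq_mul, mul_comm]

/-- `ζ` and `ζ ^ p` have the same minimal polynomial over `ℤ`, hence over `ℚ`. -/
theorem exists_algHom_adjoin_primitiveRoot {e p : ℕ} (he : 0 < e) (hpe : p.Coprime e) {ζ : ℂ}
    (hprim : IsPrimitiveRoot ζ e) :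
    ∃ σ : IntermediateField.adjoin ℚ {ζ} →ₐ[ℚ] ℂ,
      σ (IntermediateField.AdjoinSimple.gen ℚ ζ) = ζ ^ p := by
  have hint : IsIntegral ℚ ζ := (hprim.isIntegral he).tower_top
  have hroot : ζ ^ p ∈ (minpoly ℚ ζ).aroots ℂ := by
    rw [Polynomial.mem_aroots]
    refine ⟨minpoly.ne_zero hint, ?_⟩
    rw [minpoly.isIntegrallyClosed_eq_field_fractions' ℚ (hprim.isIntegral he),
      hprim.minpoly_eq_pow_coprime hpe, ← minpoly.isIntegrallyClosed_eq_field_fractions' ℚ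
      ((hprim.pow_of_coprime p hpe).isIntegral he)]
    exact minpoly.aeval _ _
  exact ⟨_, IntermediateField.algHomAdjoinIntegralEquiv_symm_apply_gen ℚ hint ⟨ζ ^ p, hroot⟩⟩

theorem exists_cyclotomicSubfield_algHom {e p : ℕ} (he : 0 < e) (hpe : p.Coprime e) :
    ∃ σ : cyclotomicSubfield e →ₐ[ℚ] ℂ,
      ∀ μ : ℂ, μ ^ e = 1 → ∃ h : μ ∈ cyclotomicSubfield e, σ ⟨μ, h⟩ = μ ^ p := by
  have : NeZero e := ⟨he.ne'⟩
  have hprim := Complex.isPrimitiveRoot_exp e he.ne'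
  obtain ⟨σ, hσ⟩ := exists_algHom_adjoin_primitiveRoot he hpe hprim
  refine ⟨σ, fun μ hμ => ?_⟩
  obtain ⟨i, -, rfl⟩ := hprim.eq_pow_of_pow_eq_one hμ
  refine ⟨pow_mem (IntermediateField.mem_adjoin_simple_self ℚ _) i, ?_⟩
  refine (map_pow σ (IntermediateField.AdjoinSimple.gen ℚ _) i).trans ?_
  rw [hσ, ← pow_mul, ← pow_mul, mul_comm p i]

theorem IsPrimitiveRoot.pow_eq_self_of_modEq {M : Type*} [CommMonoid M] {ξ : M} {d p : ℕ}
    (h : IsPrimitiveRoot ξ d) (hp : p ≡ 1 [MOD d]) : ξ ^ p = ξ := by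
  rw [h.eq_orderOf] at hp
  rw [← pow_mod_orderOf, hp, pow_mod_orderOf, pow_one]

/-- The generator `ζ_d` is an `e`-th root of unity, so `σ` sends it to `ζ_d ^ p = ζ_d`. -/
theorem algHom_eq_self_of_mem_cyclotomicSubfield {d e p : ℕ} (he : 0 < e) (hd : d ∣ e)
    (hpd : p ≡ 1 [MOD d]) (σ : cyclotomicSubfield e →ₐ[ℚ] ℂ)
    (hσ : ∀ μ : ℂ, μ ^ e = 1 → ∃ h : μ ∈ cyclotomicSubfield e, σ ⟨μ, h⟩ = μ ^ p)
    (x : cyclotomicSubfield e) (hx : (x : ℂ) ∈ cyclotomicSubfield d) : σ x = x := by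
  have hprim := Complex.isPrimitiveRoot_exp d (Nat.pos_of_dvd_of_pos hd he).ne'
  obtain ⟨hmem, hσξ⟩ := hσ _ ((hprim.pow_eq_one_iff_dvd e).mpr hd)
  have hle : cyclotomicSubfield d ≤ cyclotomicSubfield e :=
    IntermediateField.adjoin_simple_le_iff.mpr hmem
  have heq : σ.comp (IntermediateField.inclusion hle) = (cyclotomicSubfield d).val := by
    refine IntermediateField.algHom_ext_of_eq_adjoin _ rfl fun y hy => ?_
    obtain rfl : y = _ := hy
    exact hσξ.trans (hprim.pow_eq_self_of_modEq hpd)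
  exact DFunLike.congr_fun heq ⟨x, hx⟩

theorem exists_character_eq_of_hom {H V : Type*} [Group H] [AddCommGroup V] [Module ℂ V]
    [FiniteDimensional ℂ V] (ρ : Representation ℂ H V) {e p : ℕ} (he : 0 < e)
    (σ : cyclotomicSubfield e →ₐ[ℚ] ℂ)
    (hσ : ∀ μ : ℂ, μ ^ e = 1 → ∃ h : μ ∈ cyclotomicSubfield e, σ ⟨μ, h⟩ = μ ^ p)
    (z : H) (hz : z ^ e = 1) :
    ∃ x : cyclotomicSubfield e, (x : ℂ) = ρ.character z ∧ σ x = ρ.character (z ^ p) := by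
  obtain ⟨s, n, hs, h⟩ := exists_trace_pow_eq_sum (ρ z) he (by rw [← map_pow, hz, map_one])
  have h1 : ρ.character z = ∑ μ ∈ s, n μ * μ := by
    simpa [Representation.character] using h 1
  have h2 : ρ.character (z ^ p) = ∑ μ ∈ s, n μ * μ ^ p := by
    rw [← h p, Representation.character, map_pow]
  refine ⟨∑ μ : s, (n μ : cyclotomicSubfield e) * ⟨μ, (hσ μ (hs μ μ.2)).1⟩, ?_, ?_⟩
  · rw [h1, ← Finset.sum_coe_sort s fun μ => n μ * μ]
    simp
  · rw [h2, ← Finset.sum_coe_sort s fun μ => n μ * μ ^ p, map_sum]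
    refine Finset.sum_congr rfl fun μ _ => ?_
    rw [map_mul, map_natCast, (hσ μ (hs μ μ.2)).2]

end GaloisAction

/-! ### Invariance under the restricted normalizer -/

section Invariance

variable {G : Type*} [Group G] [Fintype G] [DecidableEq G]

/-- The automorphism `x ↦ t⁻¹ x t` of `C_G(g)`, for `t` in the restricted normalizer. -/
def centralizerConjEquiv {d : ℕ} {g : G} (t : restrictedNormalizer d g) :
    Subgroup.centralizer {g} ≃ Subgroup.centralizer {g} where
  toFun := centralizerConj t
  invFun := centralizerConj t⁻¹
  left_inv x := Subtype.ext (by simp [centralizerConj, mul_assoc])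
  right_inv x := Subtype.ext (by simp [centralizerConj, mul_assoc])

theorem induced_apply {d : ℕ} {g : G} [Fintype (Subgroup.centralizer {g})]
    [Fintype (restrictedNormalizer d g)]
    (η : IrrChar (Subgroup.centralizer {g})) (h : restrictedNormalizer d g) :
    η.induced (centralizer_le_restrictedNormalizer d g) h =
      (Fintype.card (Subgroup.centralizer {g}) : ℂ)⁻¹ *
        ∑ x : restrictedNormalizer d g, ∑ c : Subgroup.centralizer {g},
          if (c : G) = x * h * (x : G)⁻¹ then η c else 0 := by
  rw [IrrChar.induced, character_ind, Finset.sum_comm, η.rep_character]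
  simp only [Subtype.ext_iff, Subgroup.coe_inclusion, Subgroup.coe_mul, Subgroup.coe_inv]

theorem induced_smul {d : ℕ} {g : G} (t : restrictedNormalizer d g)
    (η : IrrChar (Subgroup.centralizer {g})) :
    (t • η).induced (centralizer_le_restrictedNormalizer d g) =
      η.induced (centralizer_le_restrictedNormalizer d g) := by
  have := Fintype.ofFinite (Subgroup.centralizer {g})
  have := Fintype.ofFinite (restrictedNormalizer d g)
  funext h
  rw [induced_apply, induced_apply]
  congr 1
  refine Fintype.sum_equiv (Equiv.mulLeft t⁻¹) _ _ fun x => ?_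
  refine Fintype.sum_equiv (centralizerConjEquiv t) _ _ fun c => ?_
  have hc : ((centralizerConjEquiv t c : Subgroup.centralizer {g}) : G) =
      (t⁻¹ * x : restrictedNormalizer d g) * h * ((t⁻¹ * x : restrictedNormalizer d g) : G)⁻¹ ↔
      (c : G) = x * h * (x : G)⁻¹ := by
    change (t : G)⁻¹ * c * t = (t : G)⁻¹ * x * h * ((t : G)⁻¹ * x)⁻¹ ↔ _
    rw [mul_inv_rev, inv_inv, ← mul_assoc, mul_left_inj, mul_assoc, mul_assoc, mul_right_inj,
      mul_assoc]
  rw [Equiv.coe_mulLeft]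
  simp only [hc]
  rfl

/-- As `N_G^d(g)` normalizes `C_G(g)`, every conjugate of `c` contributes to the induced character.
-/
theorem induced_apply_centralizer {d : ℕ} {g : G} [Fintype (Subgroup.centralizer {g})]
    [Fintype (restrictedNormalizer d g)]
    (η : IrrChar (Subgroup.centralizer {g})) (c : Subgroup.centralizer {g}) :
    η.induced (centralizer_le_restrictedNormalizer d g)
        (Subgroup.inclusion (centralizer_le_restrictedNormalizer d g) c) =
      (Fintype.card (Subgroup.centralizer {g}) : ℂ)⁻¹ *
        ∑ t : restrictedNormalizer d g, (t • η) c := by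
  rw [induced_apply]
  congr 1
  refine Fintype.sum_equiv (Equiv.inv _) _ _ fun x => ?_
  have hc (b : Subgroup.centralizer {g}) :
      (b : G) = x * (Subgroup.inclusion (centralizer_le_restrictedNormalizer d g) c :
        restrictedNormalizer d g) * (x : G)⁻¹ ↔ b = centralizerConj x⁻¹ c := by
    rw [Subtype.ext_iff]
    simp [centralizerConj]
  simp only [hc, Finset.sum_ite_eq', Finset.mem_univ, if_true]
  rfl

/-- The right side involves `η` only through its induced character. This replaces the fact that
equal induced characters come from conjugate `η`. -/
theorem sum_doubleIndicator_smul {d : ℕ} (m : ℤ) (g : G) [Fintype (Subgroup.centralizer {g})]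
    [Fintype (restrictedNormalizer d g)] (η : IrrChar (Subgroup.centralizer {g})) :
    ∑ t : restrictedNormalizer d g, doubleIndicator m g (t • η) =
      ∑ c : Subgroup.centralizer {g}, rootCount m g c *
        η.induced (centralizer_le_restrictedNormalizer d g)
          (Subgroup.inclusion (centralizer_le_restrictedNormalizer d g) c) := by
  simp only [doubleIndicator_eq, induced_apply_centralizer, Finset.mul_sum]
  rw [Finset.sum_comm]
  refine Finset.sum_congr rfl fun c _ => Finset.sum_congr rfl fun t _ => ?_
  ring

theorem doubleIndicator_eq_of_induced_eq_iff (m : ℤ) (g : G) (d : ℕ) :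
    (∀ η η' : IrrChar (Subgroup.centralizer {g}),
        η.induced (centralizer_le_restrictedNormalizer d g) =
            η'.induced (centralizer_le_restrictedNormalizer d g) →
          doubleIndicator m g η = doubleIndicator m g η') ↔
      (∀ (t : restrictedNormalizer d g) (η : IrrChar (Subgroup.centralizer {g})),
        doubleIndicator m g (t • η) = doubleIndicator m g η) := by
  refine ⟨fun h t η => h _ _ (induced_smul t η), fun h η η' hη => ?_⟩
  have := Fintype.ofFinite (Subgroup.centralizer {g})
  have := Fintype.ofFinite (restrictedNormalizer d g)
  -- Under invariance the two sums are `|N_G^d(g)|` times the single indicators.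
  have h1 := sum_doubleIndicator_smul (d := d) m g η
  rw [hη, ← sum_doubleIndicator_smul] at h1
  simp only [h, Finset.sum_const, Finset.card_univ] at h1
  exact smul_right_injective ℂ (Fintype.card_ne_zero (α := restrictedNormalizer d g)) h1

theorem exists_prime_conj_eq_pow {d : ℕ} {g : G} (hd : d ∣ Monoid.exponent G)
    (t : restrictedNormalizer d g) :
    ∃ p : ℕ, p.Prime ∧ Fintype.card G < p ∧ p.Coprime (Monoid.exponent G) ∧ p ≡ 1 [MOD d] ∧
      (t : G)⁻¹ * g * t = g ^ p := by
  -- The inverse is used because the action is `(t • η)(x) = η(t⁻¹ x t)`.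
  obtain ⟨r, hr, hrd, ht⟩ := (t⁻¹).2
  have he : Monoid.exponent G ≠ 0 := Monoid.exponent_ne_zero_of_finite
  have : NeZero (Monoid.exponent G) := ⟨he⟩
  -- Dirichlet's theorem in the residue class of `r` modulo `exp(G)`.
  obtain ⟨p, hp, hprime, hpr⟩ := Nat.forall_exists_prime_gt_and_eq_mod
    (q := Monoid.exponent G) (a := (r : ZMod (Monoid.exponent G)))
    ((ZMod.coe_int_isUnit_iff_isCoprime r _).mpr hr.symm) (Fintype.card G)
  have hmod : (p : ℤ) ≡ r [ZMOD Monoid.exponent G] := by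
    rw [← ZMod.intCast_eq_intCast_iff]
    simpa using hpr
  refine ⟨p, hprime, hp, ?_, ?_, ?_⟩
  · rw [hprime.coprime_iff_not_dvd]
    exact fun h => absurd (Nat.le_of_dvd Fintype.card_pos (h.trans Group.exponent_dvd_card))
      (not_le.mpr hp)
  · rw [← Int.natCast_modEq_iff]
    exact (hmod.of_dvd (by exact_mod_cast hd)).trans hrd
  · have h1 : (t : G)⁻¹ * g * t = g ^ r := by simpa using ht
    rw [h1, ← zpow_natCast, zpow_eq_zpow_iff_modEq]
    exact (hmod.of_dvd (by exact_mod_cast Monoid.order_dvd_exponent g)).symm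

theorem doubleIndicator_smul_of_mem_cyclotomicSubfield (m : ℤ) (g : G) {d : ℕ}
    (hd : d ∣ Monoid.exponent G) (η : IrrChar (Subgroup.centralizer {g}))
    (hη : doubleIndicator m g η ∈ cyclotomicSubfield d) (t : restrictedNormalizer d g) :
    doubleIndicator m g (t • η) = doubleIndicator m g η := by
  have := Fintype.ofFinite (Subgroup.centralizer {g})
  obtain ⟨p, hprime, hp, hpe, hpd, ht⟩ := exists_prime_conj_eq_pow hd t
  have : Fact p.Prime := ⟨hprime⟩
  have he : 0 < Monoid.exponent G := Nat.pos_of_ne_zero Monoid.exponent_ne_zero_of_finite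
  obtain ⟨σ, hσ⟩ := exists_cyclotomicSubfield_algHom he hpe
  have hcop : (Nat.card (Subgroup.centralizer {g})).Coprime p := by
    refine ((hprime.coprime_iff_not_dvd).mpr fun h => ?_).symm
    exact absurd (Nat.le_of_dvd Fintype.card_pos
      (h.trans (Nat.card_eq_fintype_card (α := G) ▸ Subgroup.card_subgroup_dvd_card _)))
      (not_le.mpr hp)
  have hχ (c : Subgroup.centralizer {g}) :
      ∃ x : cyclotomicSubfield (Monoid.exponent G), (x : ℂ) = η c ∧ σ x = η (c ^ p) := by
    have h := exists_character_eq_of_hom η.rep he σ hσ c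
      (Subtype.ext (Monoid.pow_exponent_eq_one (c : G)))
    rwa [η.rep_character] at h
  choose x hx hσx using hχ
  let ν : cyclotomicSubfield (Monoid.exponent G) :=
    (Fintype.card (Subgroup.centralizer {g}) : cyclotomicSubfield (Monoid.exponent G))⁻¹ *
      ∑ c : Subgroup.centralizer {g},
        (rootCount m g c : cyclotomicSubfield (Monoid.exponent G)) * x c
  have hν : (ν : ℂ) = doubleIndicator m g η := by
    rw [doubleIndicator_eq]
    simp [ν, hx]
  have hσν : σ ν = (Fintype.card (Subgroup.centralizer {g}) : ℂ)⁻¹ *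
      ∑ c : Subgroup.centralizer {g}, rootCount m g c * η (c ^ p) := by
    simp [ν, hσx]
  -- The hypothesis on the values enters here: `ν` lies in `ℚ(ζ_d)`, so `σ ν = ν`.
  rw [← hν, ← algHom_eq_self_of_mem_cyclotomicSubfield he hd hpd σ hσ ν (hν ▸ hη), hσν,
    doubleIndicator_eq]
  congr 1
  calc ∑ c : Subgroup.centralizer {g}, (rootCount m g c : ℂ) * (t • η) c
      = ∑ c : Subgroup.centralizer {g}, (rootCount m (g ^ p) c : ℂ) * η c := by
        refine Fintype.sum_equiv (centralizerConjEquiv t) _ _ fun c => ?_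
        have h : rootCount m (g ^ p) ((t : G)⁻¹ * c * t) = rootCount m g c := by
          rw [← ht]
          simpa using rootCount_conj m (t : G)⁻¹ g c
        rw [← h]
        rfl
    _ = ∑ c : Subgroup.centralizer {g}, (rootCount m g c : ℂ) * η (c ^ p) := by
        refine (Fintype.sum_equiv (powCoprime hcop) _ _ fun c => ?_).symm
        rw [powCoprime_apply, Subgroup.coe_pow, rootCount_pow p hp]

end Invariance

end

/-- If all `ν_m(g, η)`, `η ∈ Irr(C_G(g))`, lie in `ℚ(ζ_d)`, then `ν_m(g, η)` depends only on the
character of `N_G^d(g)` induced from `η`, and it is invariant under the action of `N_G^d(g)`;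
moreover these two properties are equivalent. -/
theorem mainTheorem10 {G : Type*} [Group G] [Fintype G] [DecidableEq G] (m : ℤ) (g : G) (d : ℕ)
    (hd : d ∣ Monoid.exponent G) :
    ((∀ η : IrrChar (Subgroup.centralizer {g}), doubleIndicator m g η ∈ cyclotomicSubfield d) →
      (∀ η η' : IrrChar (Subgroup.centralizer {g}),
        η.induced (centralizer_le_restrictedNormalizer d g) =
            η'.induced (centralizer_le_restrictedNormalizer d g) →
          doubleIndicator m g η = doubleIndicator m g η') ∧
      (∀ (t : restrictedNormalizer d g) (η : IrrChar (Subgroup.centralizer {g})),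
        doubleIndicator m g (t • η) = doubleIndicator m g η)) ∧
    ((∀ η η' : IrrChar (Subgroup.centralizer {g}),
        η.induced (centralizer_le_restrictedNormalizer d g) =
            η'.induced (centralizer_le_restrictedNormalizer d g) →
          doubleIndicator m g η = doubleIndicator m g η') ↔
      (∀ (t : restrictedNormalizer d g) (η : IrrChar (Subgroup.centralizer {g})),
        doubleIndicator m g (t • η) = doubleIndicator m g η)) := by
  have h := doubleIndicator_eq_of_induced_eq_iff m g d
  refine ⟨fun hQ => ?_, h⟩
  have hinv : ∀ (t : restrictedNormalizer d g) (η : IrrChar (Subgroup.centralizer {g})),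
      doubleIndicator m g (t • η) = doubleIndicator m g η := fun t η =>
    doubleIndicator_smul_of_mem_cyclotomicSubfield m g hd η (hQ η) t
  exact ⟨h.mpr hinv, hinv⟩
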